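/- Let $\Gamma$ be a compact connected metric graph with at least one edge and without loops or multiple edges: finite sets $V$ of vertices and $E\neq\emptyset$ of edges, each edge $e$ oriented from a vertex $i_e$ to a vertex $f_e$ and identified with an interval $[0,\ell_e]$, $0<\ell_e<\infty$. A function $u$ on $\Gamma$ is a family $([u]_e)_{e\in E}$ of functions of the coordinate $x_e$; write $\int_\Gamma u=\sum_e\int_0^{\ell_e}[u]_e\,dx_e$, and let $\ell(A)$ be the total Lebesgue measure of $A\subset\Gamma$. Let $W^{k,2}(\Gamma)$ be the set of $u$ with $[u]_e\in W^{k,2}(0,\ell_e)$ for all $e$ (no condition at the vertices); functions in $W^{1,2}(\Gamma)$ are represented by their continuous representatives on each $[0,\ell_e]$. Say that $z\in W^{1,2}(\Gamma)$ satisfies the Kirchhoff condition if $\sum_{e:\,f_e=v}[z]_e(\ell_e)-\sum_{e:\,i_e=v}[z]_e(0)=0$ for every $v\in V$, and let $X_K(\Gamma)$ be the set of such $z$. For a measurable $D\subset\Gamma$ put $$\mathrm{Per}_\Gamma(D)=\sup\Big\{\Big|\int_D z'\,dx\Big| : z\in X_K(\Gamma),\ \|z\|_{L^\infty(\Gamma)}\le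 1\Big\}\in[0,\infty],$$ $$h(\Gamma)=\inf\Big\{\frac{\mathrm{Per}_\Gamma(D)}{\min\{\ell(D),\ell(\Gamma\setminus D)\}} : D\subset\Gamma \text{ measurable},\ 0<\ell(D)<\ell(\Gamma)\Big\}.$$ Let $\Delta_\Gamma$ be the Kirchhoff Laplacian: its domain consists of the $u\in W^{2,2}(\Gamma)$ that are continuous on $\Gamma$ (including at the vertices) and whose derivative $u'$ satisfies the Kirchhoff condition, and $[\Delta_\Gamma u]_e=[u]_e''$. Theorem. The operator $-\Delta_\Gamma$ has a smallest nonzero eigenvalue $\mathrm{gap}(-\Delta_\Gamma)$, it is given by $$\mathrm{gap}(-\Delta_\Gamma)=\min\Big\{\frac{\int_\Gamma |u'|^2}{\int_\Gamma |u|^2} : u\in W^{1,2}(\Gamma) \text{ continuous on } \Gamma,\ u\not\equiv 0,\ \int_\Gamma u=0\Big\},$$ and the Cheeger inequality holds: $$\tfrac14\,h(\Gamma)^2\le \mathrm{gap}(-\Delta_\Gamma).$$ -/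

import Mathlib

open MeasureTheory Set
open scoped ENNReal ContDiff

/-- A metric graph with vertex set `V`, edge set `E`, and edges of finite positive length, without
loops and without multiple edges. Each edge `e` is oriented from `source e` to `target e` and is
identified with the interval `[0, len e]`. (It is compact when `V` and `E` are finite.) -/
structure MetricGraph (V E : Type*) where
  source : E → V
  target : E → V
  len : E → ℝ
  len_pos : ∀ e, 0 < len e
  no_loops : ∀ e, source e ≠ target e
  no_multiple_edges : Function.Injective fun e => s(source e, target e)

/-- `u` is the continuous representative on `[0, L]` of an element of the Sobolev space
`W^{1,2}(0, L)`, and `g ∈ L²(0, L)` is its weak derivative. -/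
structure IsSobolev (L : ℝ) (u g : ℝ → ℝ) : Prop where
  continuousOn : ContinuousOn u (Icc 0 L)
  memLp : MemLp g 2 (volume.restrict (Ioo 0 L))
  weak_deriv : ∀ φ : ℝ → ℝ, ContDiff ℝ ∞ φ → HasCompactSupport φ → tsupport φ ⊆ Ioo 0 L →
    ∫ x in 0..L, u x * deriv φ x = -∫ x in 0..L, g x * φ x

namespace MetricGraph

variable {V E : Type*}

/-- The underlying combinatorial graph. -/
def toSimpleGraph (Γ : MetricGraph V E) : SimpleGraph V :=
  SimpleGraph.fromEdgeSet (range fun e => s(Γ.source e, Γ.target e))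

/-- The points of the metric graph: the vertices and the interior points of the edges. -/
inductive Point (Γ : MetricGraph V E) where
  | vertex (v : V) : Point Γ
  | inner (e : E) (x : Ioo (0 : ℝ) (Γ.len e)) : Point Γ

open Classical in
/-- The point of the edge `e` with coordinate `x ∈ [0, len e]`. -/
noncomputable def point (Γ : MetricGraph V E) (e : E) (x : ℝ) : Γ.Point :=
  if hx : x ∈ Ioo 0 (Γ.len e) then .inner e ⟨x, hx⟩
  else if x ≤ 0 then .vertex (Γ.source e) else .vertex (Γ.target e)

/-- The set of coordinates, in `[0, len e]`, of the points of `A` on the edge `e`. -/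
def coords (Γ : MetricGraph V E) (A : Set Γ.Point) (e : E) : Set ℝ :=
  {x | x ∈ Icc 0 (Γ.len e) ∧ Γ.point e x ∈ A}

/-- A subset of the graph is measurable if it is Lebesgue measurable on every edge. -/
def IsMeasurable (Γ : MetricGraph V E) (A : Set Γ.Point) : Prop :=
  ∀ e, NullMeasurableSet (Γ.coords A e) volume

/-- The indicator function of a set, as a family of functions of the edge coordinates. -/
noncomputable def indicator (Γ : MetricGraph V E) (A : Set Γ.Point) : E → ℝ → ℝ :=
  fun e => (Γ.coords A e).indicator 1

/-- The functions `u e` on `[0, len e]` form an element of `W^{1,2}` of the graph (given by its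
continuous representative on each closed edge; no continuity at the vertices is required), and the
functions `g e` form its derivative. -/
def IsW12 (Γ : MetricGraph V E) (u g : E → ℝ → ℝ) : Prop :=
  ∀ e, IsSobolev (Γ.len e) (u e) (g e)

/-- The limits of `u` at a vertex along all edges incident to it agree. -/
def ContinuousAtVertices (Γ : MetricGraph V E) (u : E → ℝ → ℝ) : Prop :=
  ∃ c : V → ℝ, ∀ e, u e 0 = c (Γ.source e) ∧ u e (Γ.len e) = c (Γ.target e)

section Finite

variable [Fintype E]

/-- The length of a subset of the graph. -/
noncomputable def length (Γ : MetricGraph V E) (A : Set Γ.Point) : ℝ≥0∞ :=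
  ∑ e, volume (Γ.coords A e)

/-- The integral of a function over the graph. -/
noncomputable def integral (Γ : MetricGraph V E) (u : E → ℝ → ℝ) : ℝ :=
  ∑ e, ∫ x in 0..Γ.len e, u e x

open Classical in
/-- The Kirchhoff condition: at every vertex `v`, the values of `z` at `v` along the incident edges,
with sign `+` at a terminal point and `-` at an initial point of the edge, sum to zero. -/
def Kirchhoff (Γ : MetricGraph V E) (z : E → ℝ → ℝ) : Prop :=
  ∀ v, ∑ e, ((if Γ.target e = v then z e (Γ.len e) else 0)
    - (if Γ.source e = v then z e 0 else 0)) = 0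

/-- The total variation of `u`: the supremum of `|∫ u z'|` over all `z` in `W^{1,2}` which satisfy
the Kirchhoff condition and `‖z‖_∞ ≤ 1`. -/
noncomputable def totalVariation (Γ : MetricGraph V E) (u : E → ℝ → ℝ) : ℝ≥0∞ :=
  ⨆ (z : E → ℝ → ℝ) (g : E → ℝ → ℝ) (_ : Γ.IsW12 z g) (_ : Γ.Kirchhoff z)
    (_ : ∀ e, ∀ x ∈ Icc 0 (Γ.len e), |z e x| ≤ 1),
    ENNReal.ofReal |Γ.integral fun e x => u e x * g e x|

/-- The perimeter of a measurable set (it is `∞` exactly when the set is not of finite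
perimeter). -/
noncomputable def perimeter (Γ : MetricGraph V E) (D : Set Γ.Point) : ℝ≥0∞ :=
  Γ.totalVariation (Γ.indicator D)

/-- The Cheeger constant of the graph. Sets of infinite perimeter do not affect the infimum. -/
noncomputable def cheegerConstant (Γ : MetricGraph V E) : ℝ≥0∞ :=
  ⨅ (D : Set Γ.Point) (_ : Γ.IsMeasurable D) (_ : 0 < Γ.length D)
    (_ : Γ.length D < Γ.length univ),
    Γ.perimeter D / min (Γ.length D) (Γ.length Dᶜ)

/-- `u` lies in the domain of the Kirchhoff Laplacian (it is in `W^{2,2}`, continuous, and its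
outward normal derivatives at each vertex sum to zero), and its Laplacian is `f`. -/
def IsLaplacian (Γ : MetricGraph V E) (u f : E → ℝ → ℝ) : Prop :=
  ∃ g : E → ℝ → ℝ, Γ.IsW12 u g ∧ Γ.IsW12 g f ∧ Γ.ContinuousAtVertices u ∧ Γ.Kirchhoff g

/-- `μ` is an eigenvalue of minus the Kirchhoff Laplacian. -/
def IsEigenvalue (Γ : MetricGraph V E) (μ : ℝ) : Prop :=
  ∃ u f : E → ℝ → ℝ, Γ.IsLaplacian u f ∧ Γ.integral (fun e x => u e x ^ 2) ≠ 0 ∧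
    ∀ e, ∀ᵐ x ∂volume.restrict (Ioo 0 (Γ.len e)), -f e x = μ * u e x

/-- The nonzero eigenvalues of minus the Kirchhoff Laplacian. -/
def nonzeroEigenvalues (Γ : MetricGraph V E) : Set ℝ :=
  {μ | μ ≠ 0 ∧ Γ.IsEigenvalue μ}

/-- The spectral gap: the first nonzero eigenvalue of minus the Kirchhoff Laplacian. -/
noncomputable def spectralGap (Γ : MetricGraph V E) : ℝ :=
  sInf Γ.nonzeroEigenvalues

/-- The Rayleigh quotients `∫ |u'|² / ∫ |u|²` of the nonzero mean-zero functions `u` in the form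
domain (the continuous functions in `W^{1,2}`). -/
def rayleighQuotients (Γ : MetricGraph V E) : Set ℝ :=
  {r | ∃ u g : E → ℝ → ℝ, Γ.IsW12 u g ∧ Γ.ContinuousAtVertices u ∧
    Γ.integral (fun e x => u e x ^ 2) ≠ 0 ∧ Γ.integral u = 0 ∧
    r = Γ.integral (fun e x => g e x ^ 2) / Γ.integral (fun e x => u e x ^ 2)}

end Finite

end MetricGraph

/-!
A function lies in `W^{1,2}` exactly when it is a primitive of a square integrable function, so by
the Arzelà–Ascoli theorem a minimising sequence for the Rayleigh quotient has a uniformly convergent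
subsequence; the parallelogram identity makes its derivatives converge in `L²`, and the minimum is
attained. The Euler–Lagrange equation of a minimiser, tested with functions on a single edge, is the
eigenvalue equation, and tested with arbitrary values at the vertices it is the Kirchhoff condition
for the derivative. Conversely, an eigenfunction with nonzero eigenvalue has mean zero, and the
eigenvalue is its Rayleigh quotient.

For the Cheeger inequality, pairing the indicator of a superlevel set with `z'` and approximating it
by smooth steps gives `∫ Per {F > t} dt ≤ ∫ |F'|` for continuously differentiable `F`. If `0` is a
median of `F`, then each `{F > t}` with `t ≥ 0`, and the complement of each with `t < 0`, has at
most half of the total length, so that `h ∫ |F| ≤ ∫ |F'|`. Apply this to `F = v |v|`, where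
`v = u - m` is the eigenfunction minus a median: the Cauchy–Schwarz inequality bounds
`∫ |F'| = 2 ∫ |v| |u'|` by `2 ‖v‖ ‖u'‖`, and `‖u‖ ≤ ‖v‖` because `u` has mean zero.
-/

open Filter Topology

/-! ### Primitives of integrable functions -/

/-- `u` is a primitive of the integrable function `g` on `[a, b]`, that is, `u` is absolutely
continuous there and `g` is its derivative almost everywhere. -/
structure IsPrimitiveOn (a b : ℝ) (u g : ℝ → ℝ) : Prop where
  intervalIntegrable : IntervalIntegrable g volume a b
  eq_add_integral : ∀ x ∈ Icc a b, u x = u a + ∫ t in a..x, g t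

namespace IsPrimitiveOn

variable {a b : ℝ} {u g w h φ : ℝ → ℝ}

theorem of_hasDerivAt (hu : ∀ x, HasDerivAt u (g x) x) (hg : Continuous g) :
    IsPrimitiveOn a b u g where
  intervalIntegrable := hg.intervalIntegrable a b
  eq_add_integral x _ := by
    rw [intervalIntegral.integral_eq_sub_of_hasDerivAt (fun y _ => hu y)
      (hg.intervalIntegrable a x), add_sub_cancel]

theorem const_add_integral (hg : IntervalIntegrable g volume a b) (k : ℝ) :
    IsPrimitiveOn a b (fun x => k + ∫ t in a..x, g t) g :=
  ⟨hg, by simp⟩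

theorem intervalIntegrable_of_mem (hu : IsPrimitiveOn a b u g) {x y : ℝ} (hx : x ∈ Icc a b)
    (hy : y ∈ Icc a b) : IntervalIntegrable g volume x y :=
  hu.intervalIntegrable.mono_set (uIcc_subset_uIcc (Icc_subset_uIcc hx) (Icc_subset_uIcc hy))

theorem sub_eq_integral (hab : a ≤ b) (hu : IsPrimitiveOn a b u g) {x y : ℝ} (hx : x ∈ Icc a b)
    (hy : y ∈ Icc a b) : u y - u x = ∫ t in x..y, g t := by
  have ha := left_mem_Icc.2 hab
  rw [hu.eq_add_integral x hx, hu.eq_add_integral y hy, add_sub_add_left_eq_sub,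
    intervalIntegral.integral_interval_sub_left (hu.intervalIntegrable_of_mem ha hy)
      (hu.intervalIntegrable_of_mem ha hx)]

theorem add (hu : IsPrimitiveOn a b u g) (hw : IsPrimitiveOn a b w h) :
    IsPrimitiveOn a b (u + w) (g + h) where
  intervalIntegrable := hu.intervalIntegrable.add hw.intervalIntegrable
  eq_add_integral x hx := by
    have ha := left_mem_Icc.2 (hx.1.trans hx.2)
    simp only [Pi.add_apply]
    rw [hu.eq_add_integral x hx, hw.eq_add_integral x hx, intervalIntegral.integral_add
      (hu.intervalIntegrable_of_mem ha hx) (hw.intervalIntegrable_of_mem ha hx)]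
    ring

theorem const_smul (hu : IsPrimitiveOn a b u g) (c : ℝ) :
    IsPrimitiveOn a b (c • u) (c • g) where
  intervalIntegrable := hu.intervalIntegrable.const_mul c
  eq_add_integral x hx := by
    simp only [Pi.smul_apply, smul_eq_mul, intervalIntegral.integral_const_mul]
    rw [hu.eq_add_integral x hx, mul_add]

theorem continuousOn (hab : a ≤ b) (hu : IsPrimitiveOn a b u g) : ContinuousOn u (Icc a b) := by
  have hcont :=
    intervalIntegral.continuousOn_primitive_interval' hu.intervalIntegrable left_mem_uIcc
  rw [uIcc_of_le hab] at hcont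
  exact (hcont.const_add (u a)).congr hu.eq_add_integral

theorem integral_mul_add_mul (hab : a ≤ b) (hu : IsPrimitiveOn a b u g)
    (hw : IsPrimitiveOn a b w h) :
    ∫ x in a..b, (g x * w x + u x * h x) = u b * w b - u a * w a := by
  have absolutelyContinuous : ∀ {g : ℝ → ℝ} (c : ℝ), IntervalIntegrable g volume a b →
      AbsolutelyContinuousOnInterval (fun x => c + ∫ t in a..x, g t) a b := fun c hg =>
    ((LipschitzWith.const c).lipschitzOnWith.absolutelyContinuousOnInterval).add
      (hg.absolutelyContinuousOnInterval_intervalIntegral left_mem_uIcc)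
  have parts := (absolutelyContinuous (u a) hu.intervalIntegrable).integral_deriv_mul_eq_sub
    (absolutelyContinuous (w a) hw.intervalIntegrable)
  simp only [intervalIntegral.integral_same, add_zero] at parts
  rw [hu.eq_add_integral b (right_mem_Icc.2 hab), hw.eq_add_integral b (right_mem_Icc.2 hab),
    ← parts]
  apply intervalIntegral.integral_congr_ae
  filter_upwards [hu.intervalIntegrable.ae_hasDerivAt_integral,
    hw.intervalIntegrable.ae_hasDerivAt_integral] with x hgx hhx hx
  have hx' : x ∈ uIcc a b := uIoc_subset_uIcc hx
  have hx'' : x ∈ Icc a b := by rwa [uIcc_of_le hab] at hx'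
  rw [((hgx hx' a left_mem_uIcc).const_add (u a)).deriv,
    ((hhx hx' a left_mem_uIcc).const_add (w a)).deriv, hu.eq_add_integral x hx'',
    hw.eq_add_integral x hx'']

theorem integral_mul_deriv_eq_neg (hab : a ≤ b) (hu : IsPrimitiveOn a b u g)
    (hφ : ContDiff ℝ ∞ φ) (hsupp : tsupport φ ⊆ Ioo a b) :
    ∫ x in a..b, u x * deriv φ x = -∫ x in a..b, g x * φ x := by
  have hdφ : Continuous (deriv φ) := hφ.continuous_deriv (by simp)
  have hφb : φ b = 0 := image_eq_zero_of_notMem_tsupport fun hb => (hsupp hb).2.false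
  have hφa : φ a = 0 := image_eq_zero_of_notMem_tsupport fun ha => (hsupp ha).1.false
  have hcont : ContinuousOn u (uIcc a b) := by
    rw [uIcc_of_le hab]
    exact hu.continuousOn hab
  have parts := hu.integral_mul_add_mul hab
    (of_hasDerivAt (fun x => (hφ.differentiable (by simp) x).hasDerivAt) hdφ)
  rw [intervalIntegral.integral_add
    (hu.intervalIntegrable.mul_continuousOn hφ.continuous.continuousOn)
    ((hdφ.intervalIntegrable _ _).continuousOn_mul hcont), hφa, hφb] at parts
  linarith

end IsPrimitiveOn

section DuBoisReymond

variable {a b : ℝ} {w u g χ : ℝ → ℝ}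

theorem hasCompactSupport_of_tsupport_subset_Ioo (hsupp : tsupport χ ⊆ Ioo a b) :
    HasCompactSupport χ :=
  isCompact_Icc.of_isClosed_subset (isClosed_tsupport χ) (hsupp.trans Ioo_subset_Icc_self)

theorem tsupport_integral_subset_Ioo (hχ : Continuous χ) (hsupp : tsupport χ ⊆ Ioo a b)
    (hzero : ∫ x in a..b, χ x = 0) :
    tsupport (fun x => ∫ t in a..x, χ t) ⊆ Ioo a b := by
  obtain ⟨c, d, hac, hdb, hcd⟩ : ∃ c d, a < c ∧ d < b ∧ tsupport χ ⊆ Icc c d := by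
    rcases (tsupport χ).eq_empty_or_nonempty with hempty | hne
    · exact ⟨a + 1, b - 1, by linarith, by linarith, by simp [hempty]⟩
    · have hcompact : IsCompact (tsupport χ) := hasCompactSupport_of_tsupport_subset_Ioo hsupp
      obtain ⟨c, hc, hc_le⟩ := hcompact.exists_isLeast hne
      obtain ⟨d, hd, hle_d⟩ := hcompact.exists_isGreatest hne
      exact ⟨c, d, (hsupp hc).1, (hsupp hd).2, fun x hx => ⟨hc_le hx, hle_d hx⟩⟩
  have integral_eq_zero : ∀ {y z}, (∀ t ∈ uIoc y z, t ∉ Icc c d) → ∫ t in y..z, χ t = 0 :=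
    fun hyz => intervalIntegral.integral_zero_ae <| ae_of_all _ fun t ht =>
      image_eq_zero_of_notMem_tsupport fun hmem => hyz t ht (hcd hmem)
  refine (closure_minimal (fun x hx => ?_) isClosed_Icc).trans (Icc_subset_Ioo hac hdb)
  by_contra hxcd
  rcases lt_or_ge x c with hxc | hcx
  · exact hx (integral_eq_zero fun t ht htcd =>
      (ht.2.trans_lt (max_lt hac hxc)).not_ge htcd.1)
  · have hdx : d < x := lt_of_not_ge fun hxd => hxcd ⟨hcx, hxd⟩
    refine hx ?_
    change ∫ t in a..x, χ t = 0
    rw [← intervalIntegral.integral_add_adjacent_intervals (b := b)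
      (hχ.intervalIntegrable _ _) (hχ.intervalIntegrable _ _), hzero, zero_add]
    exact integral_eq_zero fun t ht htcd => ((lt_min hdb hdx).trans ht.1).not_ge htcd.2

theorem exists_deriv_eq_of_integral_eq_zero (hχ : ContDiff ℝ ∞ χ) (hsupp : tsupport χ ⊆ Ioo a b)
    (hzero : ∫ x in a..b, χ x = 0) :
    ∃ φ : ℝ → ℝ, ContDiff ℝ ∞ φ ∧ tsupport φ ⊆ Ioo a b ∧ deriv φ = χ := by
  have hderiv : ∀ x, HasDerivAt (fun x => ∫ t in a..x, χ t) (χ x) x := fun x =>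
    (hχ.continuous.integral_hasStrictDerivAt a x).hasDerivAt
  have hderiv' : deriv (fun x => ∫ t in a..x, χ t) = χ := funext fun x => (hderiv x).deriv
  refine ⟨_, contDiff_infty_iff_deriv.2 ⟨fun x => (hderiv x).differentiableAt, ?_⟩,
    tsupport_integral_subset_Ioo hχ.continuous hsupp hzero, hderiv'⟩
  rwa [hderiv']

theorem exists_contDiff_tsupport_subset_Ioo_integral_eq_one (hab : a < b) :
    ∃ φ : ℝ → ℝ, ContDiff ℝ ∞ φ ∧ tsupport φ ⊆ Ioo a b ∧ ∫ x in a..b, φ x = 1 := by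
  let bump : ContDiffBump ((a + b) / 2) := ⟨(b - a) / 8, (b - a) / 4, by linarith, by linarith⟩
  have hsupp : tsupport (bump.normed volume) ⊆ Ioo a b := by
    rw [bump.tsupport_normed_eq, Real.closedBall_eq_Icc]
    exact Icc_subset_Ioo (by change a < _ - (b - a) / 4; linarith)
      (by change _ + (b - a) / 4 < b; linarith)
  refine ⟨_, bump.contDiff_normed, hsupp, ?_⟩
  rw [intervalIntegral.integral_eq_integral_of_support_subset
    ((subset_tsupport _).trans (hsupp.trans Ioo_subset_Ioc_self)), bump.integral_normed]

theorem exists_integral_mul_eq_mul_integral (hab : a < b) (hw : IntervalIntegrable w volume a b)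
    (hweak : ∀ φ : ℝ → ℝ, ContDiff ℝ ∞ φ → tsupport φ ⊆ Ioo a b →
      ∫ x in a..b, w x * deriv φ x = 0) :
    ∃ k, ∀ ψ : ℝ → ℝ, ContDiff ℝ ∞ ψ → tsupport ψ ⊆ Ioo a b →
      ∫ x in a..b, w x * ψ x = k * ∫ x in a..b, ψ x := by
  obtain ⟨φ₀, hφ₀, hsupp₀, hone⟩ := exists_contDiff_tsupport_subset_Ioo_integral_eq_one hab
  refine ⟨∫ x in a..b, w x * φ₀ x, fun ψ hψ hsupp => ?_⟩
  set J := ∫ x in a..b, ψ x with hJ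
  obtain ⟨φ, hφ, hφsupp, hφψ⟩ :=
    exists_deriv_eq_of_integral_eq_zero (χ := fun x => ψ x - J * φ₀ x)
      (hψ.sub (contDiff_const.mul hφ₀))
      ((tsupport_sub ψ _).trans (union_subset hsupp
        ((tsupport_mul_subset_right (f := fun _ => J)).trans hsupp₀)))
      (by rw [intervalIntegral.integral_sub (hψ.continuous.intervalIntegrable _ _)
        ((hφ₀.continuous.const_mul J).intervalIntegrable _ _),
        intervalIntegral.integral_const_mul, hone, mul_one, ← hJ, sub_self])
  have hφw := hweak φ hφ hφsupp
  simp only [hφψ, mul_sub, mul_left_comm _ J] at hφw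
  rw [intervalIntegral.integral_sub (hw.mul_continuousOn hψ.continuous.continuousOn)
    ((hw.mul_continuousOn hφ₀.continuous.continuousOn).const_mul J),
    intervalIntegral.integral_const_mul] at hφw
  linarith

theorem exists_ae_eq_const_of_integral_mul_deriv_eq_zero (hab : a < b)
    (hw : IntervalIntegrable w volume a b)
    (hweak : ∀ φ : ℝ → ℝ, ContDiff ℝ ∞ φ → tsupport φ ⊆ Ioo a b →
      ∫ x in a..b, w x * deriv φ x = 0) :
    ∃ k, ∀ᵐ x ∂volume.restrict (Ioo a b), w x = k := by
  obtain ⟨k, hk⟩ := exists_integral_mul_eq_mul_integral hab hw hweak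
  have hwIoo : IntegrableOn (fun x => w x - k) (Ioo a b) :=
    ((intervalIntegrable_iff_integrableOn_Ioo_of_le hab.le).1 hw).sub
      (integrableOn_const (by simp))
  have hzero := isOpen_Ioo.ae_eq_zero_of_integral_contDiff_smul_eq_zero
    hwIoo.locallyIntegrableOn fun ψ hψ _ hsupp => by
      have hsupp' : Function.support (fun x => ψ x • (w x - k)) ⊆ Ioc a b :=
        (Function.support_smul_subset_left ψ fun x => w x - k).trans
          ((subset_tsupport ψ).trans (hsupp.trans Ioo_subset_Ioc_self))
      rw [← intervalIntegral.integral_eq_integral_of_support_subset hsupp']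
      simp only [smul_eq_mul, mul_comm (ψ _), sub_mul]
      rw [intervalIntegral.integral_sub (hw.mul_continuousOn hψ.continuous.continuousOn)
        ((hψ.continuous.const_mul k).intervalIntegrable _ _),
        intervalIntegral.integral_const_mul, hk ψ hψ hsupp, sub_self]
  exact ⟨k, (ae_restrict_iff' measurableSet_Ioo).2
    (hzero.mono fun x hx hxI => sub_eq_zero.1 (hx hxI))⟩

theorem isPrimitiveOn_of_weak_deriv (hab : a < b) (hu : ContinuousOn u (Icc a b))
    (hg : IntervalIntegrable g volume a b)
    (hweak : ∀ φ : ℝ → ℝ, ContDiff ℝ ∞ φ → tsupport φ ⊆ Ioo a b →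
      ∫ x in a..b, u x * deriv φ x = -∫ x in a..b, g x * φ x) : IsPrimitiveOn a b u g := by
  have hP := IsPrimitiveOn.const_add_integral hg 0
  have hPcont := hP.continuousOn hab.le
  obtain ⟨k, hk⟩ := exists_ae_eq_const_of_integral_mul_deriv_eq_zero hab
    (w := fun x => u x - (0 + ∫ t in a..x, g t))
    ((hu.sub hPcont).intervalIntegrable_of_Icc hab.le) fun φ hφ hsupp => by
      have int_mul : ∀ {v : ℝ → ℝ}, ContinuousOn v (Icc a b) →
          IntervalIntegrable (fun x => v x * deriv φ x) volume a b := fun hv =>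
        (hv.mul (hφ.continuous_deriv (by simp)).continuousOn).intervalIntegrable_of_Icc hab.le
      simp only [sub_mul]
      rw [intervalIntegral.integral_sub (int_mul hu) (int_mul hPcont), hweak φ hφ hsupp,
        hP.integral_mul_deriv_eq_neg hab.le hφ hsupp, sub_self]
  rw [restrict_Ioo_eq_restrict_Icc] at hk
  have heq : EqOn (fun x => u x - (0 + ∫ t in a..x, g t)) (fun _ => k) (Icc a b) :=
    Measure.eqOn_Icc_of_ae_eq volume hab.ne hk (hu.sub hPcont) continuousOn_const
  have hka := heq (left_mem_Icc.2 hab.le)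
  simp only [intervalIntegral.integral_same, add_zero, sub_zero] at hka
  refine ⟨hg, fun x hx => ?_⟩
  have hkx : u x - (0 + ∫ t in a..x, g t) = k := heq hx
  linarith

end DuBoisReymond

theorem isSobolev_iff {L : ℝ} (hL : 0 < L) {u g : ℝ → ℝ} :
    IsSobolev L u g ↔ IsPrimitiveOn 0 L u g ∧ MemLp g 2 (volume.restrict (Ioo 0 L)) := by
  constructor
  · intro hu
    have hg : IntervalIntegrable g volume 0 L :=
      (intervalIntegrable_iff_integrableOn_Ioo_of_le hL.le).2 (hu.memLp.integrable one_le_two)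
    exact ⟨isPrimitiveOn_of_weak_deriv hL hu.continuousOn hg fun φ hφ hsupp => hu.weak_deriv φ hφ
      (hasCompactSupport_of_tsupport_subset_Ioo hsupp) hsupp, hu.memLp⟩
  · rintro ⟨hu, hg⟩
    exact ⟨hu.continuousOn hL.le, hg, fun φ hφ _ hsupp =>
      hu.integral_mul_deriv_eq_neg hL.le hφ hsupp⟩

section L2

variable {α : Type*} [MeasurableSpace α] {μ : Measure α} {f g : α → ℝ}

theorem inner_toLp_toLp (hf : MemLp f 2 μ) (hg : MemLp g 2 μ) :
    inner ℝ (hf.toLp f) (hg.toLp g) = ∫ x, f x * g x ∂μ := by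
  rw [L2.inner_def]
  refine integral_congr_ae ?_
  filter_upwards [hf.coeFn_toLp, hg.coeFn_toLp] with x hfx hgx
  rw [hfx, hgx, real_inner_comm]
  rfl

theorem norm_toLp_sq (hf : MemLp f 2 μ) : ‖hf.toLp f‖ ^ 2 = ∫ x, f x ^ 2 ∂μ := by
  rw [← real_inner_self_eq_norm_sq, inner_toLp_toLp]
  simp only [sq]

theorem sq_integral_mul_le (hf : MemLp f 2 μ) (hg : MemLp g 2 μ) :
    (∫ x, f x * g x ∂μ) ^ 2 ≤ (∫ x, f x ^ 2 ∂μ) * ∫ x, g x ^ 2 ∂μ := by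
  rw [← inner_toLp_toLp hf hg, ← norm_toLp_sq hf, ← norm_toLp_sq hg, ← mul_pow, ← sq_abs]
  exact pow_le_pow_left₀ (abs_nonneg _) (abs_real_inner_le_norm _ _) 2

end L2

theorem IsSobolev.abs_sub_le {L : ℝ} (hL : 0 < L) {u g : ℝ → ℝ} (hu : IsSobolev L u g) {x y : ℝ}
    (hx : x ∈ Icc 0 L) (hy : y ∈ Icc 0 L) :
    |u y - u x| ≤ √|y - x| * √(∫ t in 0..L, g t ^ 2) := by
  wlog hxy : x ≤ y generalizing x y
  · rw [abs_sub_comm, abs_sub_comm y]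
    exact this hy hx (le_of_not_ge hxy)
  have hg : MemLp g 2 (volume.restrict (Ioc 0 L)) := by
    rw [← restrict_Ioo_eq_restrict_Ioc]
    exact hu.memLp
  have hgxy : MemLp g 2 (volume.restrict (Ioc x y)) :=
    hg.mono_measure (Measure.restrict_mono (Ioc_subset_Ioc hx.1 hy.2) le_rfl)
  rw [← Real.sqrt_mul (abs_nonneg _), abs_of_nonneg (sub_nonneg.2 hxy)]
  refine Real.abs_le_sqrt ?_
  calc (u y - u x) ^ 2 = (∫ t in Ioc x y, 1 * g t) ^ 2 := by
        rw [((isSobolev_iff hL).1 hu).1.sub_eq_integral hL.le hx hy,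
          intervalIntegral.integral_of_le hxy]
        simp only [one_mul]
    _ ≤ (∫ _ in Ioc x y, 1 ^ 2) * ∫ t in Ioc x y, g t ^ 2 :=
        sq_integral_mul_le (memLp_const 1) hgxy
    _ = (y - x) * ∫ t in Ioc x y, g t ^ 2 := by
        simp [hxy]
    _ ≤ (y - x) * ∫ t in 0..L, g t ^ 2 := by
        rw [intervalIntegral.integral_of_le hL.le]
        exact mul_le_mul_of_nonneg_left (setIntegral_mono_set hg.integrable_sq
          (ae_of_all _ fun _ => sq_nonneg _) (Ioc_subset_Ioc hx.1 hy.2).eventuallyLE)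
          (sub_nonneg.2 hxy)

/-! ### The space `W^{1,2}` of a metric graph -/

namespace MetricGraph

variable {V E : Type*} {Γ : MetricGraph V E}

section FormDomain

variable {u w g h f z : E → ℝ → ℝ}

theorem zero_mem_Icc (Γ : MetricGraph V E) (e : E) : (0 : ℝ) ∈ Icc 0 (Γ.len e) :=
  left_mem_Icc.2 (Γ.len_pos e).le

theorem len_mem_Icc (Γ : MetricGraph V E) (e : E) : Γ.len e ∈ Icc 0 (Γ.len e) :=
  right_mem_Icc.2 (Γ.len_pos e).le

/-- The functions which are integrable on every edge. -/
def IsL1 (Γ : MetricGraph V E) (u : E → ℝ → ℝ) : Prop :=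
  ∀ e, IntervalIntegrable (u e) volume 0 (Γ.len e)

/-- The functions which are square integrable on every edge. -/
def IsL2 (Γ : MetricGraph V E) (u : E → ℝ → ℝ) : Prop :=
  ∀ e, MemLp (u e) 2 (volume.restrict (Ioo 0 (Γ.len e)))

theorem isL1_of_continuousOn (hu : ∀ e, ContinuousOn (u e) (Icc 0 (Γ.len e))) : Γ.IsL1 u :=
  fun e => (hu e).intervalIntegrable_of_Icc (Γ.len_pos e).le

theorem isL2_of_continuousOn (hu : ∀ e, ContinuousOn (u e) (Icc 0 (Γ.len e))) : Γ.IsL2 u := by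
  intro e
  obtain ⟨C, hC⟩ := isCompact_Icc.exists_bound_of_continuousOn (hu e)
  rw [restrict_Ioo_eq_restrict_Icc]
  exact .of_bound ((hu e).aestronglyMeasurable measurableSet_Icc) C
    ((ae_restrict_iff' measurableSet_Icc).2 (ae_of_all _ hC))

theorem IsL2.add (hg : Γ.IsL2 g) (hh : Γ.IsL2 h) : Γ.IsL2 (g + h) := fun e => (hg e).add (hh e)

theorem IsL2.sub (hg : Γ.IsL2 g) (hh : Γ.IsL2 h) : Γ.IsL2 (g - h) := fun e => (hg e).sub (hh e)

theorem IsL2.const_smul (hg : Γ.IsL2 g) (c : ℝ) : Γ.IsL2 (c • g) := fun e => (hg e).const_smul c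

theorem IsL2.isL1 (hg : Γ.IsL2 g) : Γ.IsL1 g := fun e =>
  (intervalIntegrable_iff_integrableOn_Ioo_of_le (Γ.len_pos e).le).2 ((hg e).integrable one_le_two)

theorem IsL2.isL1_mul (hg : Γ.IsL2 g) (hh : Γ.IsL2 h) : Γ.IsL1 (g * h) := fun e =>
  (intervalIntegrable_iff_integrableOn_Ioo_of_le (Γ.len_pos e).le).2 ((hg e).integrable_mul (hh e))

theorem IsL2.isL1_sq (hg : Γ.IsL2 g) : Γ.IsL1 (g ^ 2) := by
  rw [sq]
  exact hg.isL1_mul hg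

theorem isW12_iff : Γ.IsW12 u g ↔ (∀ e, IsPrimitiveOn 0 (Γ.len e) (u e) (g e)) ∧ Γ.IsL2 g := by
  simp only [IsW12, isSobolev_iff (Γ.len_pos _), forall_and, IsL2]

theorem IsW12.isPrimitiveOn (hu : Γ.IsW12 u g) (e : E) : IsPrimitiveOn 0 (Γ.len e) (u e) (g e) :=
  (isW12_iff.1 hu).1 e

theorem IsW12.isL2_deriv (hu : Γ.IsW12 u g) : Γ.IsL2 g := (isW12_iff.1 hu).2

theorem IsW12.isL2 (hu : Γ.IsW12 u g) : Γ.IsL2 u :=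
  isL2_of_continuousOn fun e => (hu e).continuousOn

theorem IsW12.congr_deriv (hu : Γ.IsW12 u g)
    (hgh : ∀ e, g e =ᵐ[volume.restrict (Ioo 0 (Γ.len e))] h e) : Γ.IsW12 u h := fun e => by
  refine ⟨(hu e).continuousOn, (memLp_congr_ae (hgh e)).1 (hu e).memLp, fun φ hφ hφc hφs => ?_⟩
  rw [(hu e).weak_deriv φ hφ hφc hφs, intervalIntegral.integral_of_le (Γ.len_pos e).le,
    intervalIntegral.integral_of_le (Γ.len_pos e).le, ← restrict_Ioo_eq_restrict_Ioc]
  congr 1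
  exact integral_congr_ae ((hgh e).mul (ae_eq_refl φ))

/-- The form domain of the Kirchhoff Laplacian, as the space of the pairs of a continuous
function in `W^{1,2}` and its derivative. -/
def formDomain (Γ : MetricGraph V E) : Submodule ℝ ((E → ℝ → ℝ) × (E → ℝ → ℝ)) where
  carrier := {p | Γ.IsW12 p.1 p.2 ∧ Γ.ContinuousAtVertices p.1}
  zero_mem' := ⟨isW12_iff.2
    ⟨fun e => .of_hasDerivAt (fun x => hasDerivAt_const x 0) continuous_const, fun _ => .zero⟩,
    0, by simp⟩
  add_mem' := by
    rintro p q ⟨hp, c, hc⟩ ⟨hq, d, hd⟩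
    exact ⟨isW12_iff.2 ⟨fun e => (hp.isPrimitiveOn e).add (hq.isPrimitiveOn e),
      hp.isL2_deriv.add hq.isL2_deriv⟩, c + d, by simp [hc, hd]⟩
  smul_mem' := by
    rintro t p ⟨hp, c, hc⟩
    exact ⟨isW12_iff.2 ⟨fun e => (hp.isPrimitiveOn e).const_smul t, hp.isL2_deriv.const_smul t⟩,
      t • c, by simp [hc]⟩

theorem mem_formDomain_of_hasDerivAt (hu : ∀ e x, HasDerivAt (u e) (g e x) x)
    (hg : ∀ e, Continuous (g e)) (hv : Γ.ContinuousAtVertices u) : (u, g) ∈ Γ.formDomain :=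
  ⟨isW12_iff.2 ⟨fun e => .of_hasDerivAt (hu e) (hg e),
    isL2_of_continuousOn fun e => (hg e).continuousOn⟩, hv⟩

theorem const_mem_formDomain (Γ : MetricGraph V E) (k : ℝ) :
    ((fun _ _ => k, 0) : (E → ℝ → ℝ) × (E → ℝ → ℝ)) ∈ Γ.formDomain :=
  mem_formDomain_of_hasDerivAt (fun _ x => hasDerivAt_const x k) (fun _ => continuous_const)
    ⟨fun _ => k, by simp⟩

theorem exists_mem_formDomain_of_vertexValues (Γ : MetricGraph V E) (c : V → ℝ) :
    ∃ p ∈ Γ.formDomain, ∀ e, p.1 e 0 = c (Γ.source e) ∧ p.1 e (Γ.len e) = c (Γ.target e) := by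
  set slope : E → ℝ := fun e => (c (Γ.target e) - c (Γ.source e)) / Γ.len e with hslope
  have hends : ∀ e, c (Γ.source e) + slope e * 0 = c (Γ.source e) ∧
      c (Γ.source e) + slope e * Γ.len e = c (Γ.target e) := fun e => by
    simp [hslope, (Γ.len_pos e).ne']
  exact ⟨(fun e x => c (Γ.source e) + slope e * x, fun e _ => slope e),
    mem_formDomain_of_hasDerivAt
      (fun e x => by
        simpa using ((hasDerivAt_id' x).const_mul (slope e)).const_add (c (Γ.source e)))
      (fun _ => continuous_const) ⟨c, hends⟩, hends⟩

theorem primitive_mem_formDomain (hh : Γ.IsL2 h) (hmean : ∀ e, ∫ x in 0..Γ.len e, h e x = 0) :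
    ((fun e x => ∫ t in 0..x, h e t, h) : (E → ℝ → ℝ) × (E → ℝ → ℝ)) ∈ Γ.formDomain :=
  ⟨isW12_iff.2 ⟨fun e => by simpa using IsPrimitiveOn.const_add_integral (hh.isL1 e) 0, hh⟩,
    0, fun e => by simp [hmean e]⟩

end FormDomain

section Integral

variable [Fintype E] {u w g h f z : E → ℝ → ℝ}

theorem integral_add (hu : Γ.IsL1 u) (hw : Γ.IsL1 w) :
    Γ.integral (u + w) = Γ.integral u + Γ.integral w := by
  rw [integral, integral, integral, ← Finset.sum_add_distrib]
  exact Finset.sum_congr rfl fun e _ => intervalIntegral.integral_add (hu e) (hw e)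

theorem integral_smul (Γ : MetricGraph V E) (c : ℝ) (u : E → ℝ → ℝ) :
    Γ.integral (c • u) = c * Γ.integral u := by
  simp [integral, Finset.mul_sum]

theorem integral_const (Γ : MetricGraph V E) (k : ℝ) :
    Γ.integral (fun _ _ => k) = k * ∑ e, Γ.len e := by
  simp [integral, Finset.mul_sum, mul_comm]

theorem integral_mono (hu : Γ.IsL1 u) (hw : Γ.IsL1 w)
    (huw : ∀ e, ∀ x ∈ Icc 0 (Γ.len e), u e x ≤ w e x) : Γ.integral u ≤ Γ.integral w :=
  Finset.sum_le_sum fun e _ =>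
    intervalIntegral.integral_mono_on (Γ.len_pos e).le (hu e) (hw e) (huw e)

theorem integral_congr_ae (huw : ∀ e, u e =ᵐ[volume.restrict (Ioo 0 (Γ.len e))] w e) :
    Γ.integral u = Γ.integral w := by
  refine Finset.sum_congr rfl fun e _ => ?_
  simp only [intervalIntegral.integral_of_le (Γ.len_pos e).le, ← restrict_Ioo_eq_restrict_Ioc]
  exact MeasureTheory.integral_congr_ae (huw e)

/-- The inner product of `L²` of the graph. -/
noncomputable def l2Inner (Γ : MetricGraph V E) (u w : E → ℝ → ℝ) : ℝ :=
  Γ.integral fun e x => u e x * w e x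

/-- The squared norm of `L²` of the graph. -/
noncomputable def l2NormSq (Γ : MetricGraph V E) (u : E → ℝ → ℝ) : ℝ :=
  Γ.integral fun e x => u e x ^ 2

theorem l2NormSq_nonneg (Γ : MetricGraph V E) (u : E → ℝ → ℝ) : 0 ≤ Γ.l2NormSq u :=
  Finset.sum_nonneg fun e _ =>
    intervalIntegral.integral_nonneg (Γ.len_pos e).le fun _ _ => sq_nonneg _

theorem l2NormSq_eq_l2Inner (Γ : MetricGraph V E) (u : E → ℝ → ℝ) :
    Γ.l2NormSq u = Γ.l2Inner u u := by
  simp only [l2NormSq, l2Inner, sq]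

theorem l2Inner_comm (Γ : MetricGraph V E) (u w : E → ℝ → ℝ) : Γ.l2Inner u w = Γ.l2Inner w u := by
  simp only [l2Inner, mul_comm]

theorem l2Inner_add_left (hu : Γ.IsL2 u) (hw : Γ.IsL2 w) (hg : Γ.IsL2 g) :
    Γ.l2Inner (u + w) g = Γ.l2Inner u g + Γ.l2Inner w g := by
  rw [l2Inner, l2Inner, l2Inner]
  simp only [Pi.add_apply, add_mul]
  exact integral_add (hu.isL1_mul hg) (hw.isL1_mul hg)

theorem l2Inner_smul_left (Γ : MetricGraph V E) (c : ℝ) (u w : E → ℝ → ℝ) :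
    Γ.l2Inner (c • u) w = c * Γ.l2Inner u w := by
  rw [l2Inner, l2Inner, ← integral_smul]
  simp [Pi.smul_def, mul_assoc]

theorem l2NormSq_smul (Γ : MetricGraph V E) (c : ℝ) (u : E → ℝ → ℝ) :
    Γ.l2NormSq (c • u) = c ^ 2 * Γ.l2NormSq u := by
  rw [l2NormSq_eq_l2Inner, l2Inner_smul_left, l2Inner_comm, l2Inner_smul_left,
    ← l2NormSq_eq_l2Inner]
  ring

theorem l2NormSq_add_smul (hu : Γ.IsL2 u) (hw : Γ.IsL2 w) (t : ℝ) :
    Γ.l2NormSq (u + t • w)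
      = Γ.l2NormSq u + 2 * t * Γ.l2Inner u w + t ^ 2 * Γ.l2NormSq w := by
  have htw := hw.const_smul t
  rw [l2NormSq_eq_l2Inner, l2Inner_add_left hu htw (hu.add htw), l2Inner_comm Γ u,
    l2Inner_comm Γ (t • w), l2Inner_add_left hu htw hu, l2Inner_add_left hu htw htw,
    l2Inner_comm Γ u (t • w), ← l2NormSq_eq_l2Inner, ← l2NormSq_eq_l2Inner, l2NormSq_smul,
    l2Inner_smul_left, l2Inner_comm Γ w]
  ring

theorem l2NormSq_add_add_l2NormSq_sub (hu : Γ.IsL2 u) (hw : Γ.IsL2 w) :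
    Γ.l2NormSq (u + w) + Γ.l2NormSq (u - w) = 2 * Γ.l2NormSq u + 2 * Γ.l2NormSq w := by
  have hadd := l2NormSq_add_smul hu hw 1
  have hsub := l2NormSq_add_smul hu hw (-1)
  rw [one_smul] at hadd
  rw [neg_one_smul, ← sub_eq_add_neg] at hsub
  linarith

theorem sq_l2Inner_le (hu : Γ.IsL2 u) (hw : Γ.IsL2 w) :
    Γ.l2Inner u w ^ 2 ≤ Γ.l2NormSq u * Γ.l2NormSq w := by
  have hdiscrim : discrim (Γ.l2NormSq w) (2 * Γ.l2Inner u w) (Γ.l2NormSq u) ≤ 0 :=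
    discrim_le_zero fun t => by
      linarith [Γ.l2NormSq_nonneg (u + t • w), l2NormSq_add_smul hu hw t]
  rw [discrim] at hdiscrim
  linarith

theorem ae_eq_zero_of_l2NormSq_eq_zero (hu : Γ.IsL2 u) (h0 : Γ.l2NormSq u = 0) (e : E) :
    u e =ᵐ[volume.restrict (Ioo 0 (Γ.len e))] 0 := by
  have hedge : ∫ x in 0..Γ.len e, u e x ^ 2 = 0 :=
    (Finset.sum_eq_zero_iff_of_nonneg fun e _ => intervalIntegral.integral_nonneg
      (Γ.len_pos e).le fun _ _ => sq_nonneg _).1 h0 e (Finset.mem_univ e)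
  rw [intervalIntegral.integral_of_le (Γ.len_pos e).le, ← restrict_Ioo_eq_restrict_Ioc] at hedge
  filter_upwards [(integral_eq_zero_iff_of_nonneg (fun _ => sq_nonneg _)
    (hu e).integrable_sq).1 hedge] with x hx
  exact pow_eq_zero_iff two_ne_zero |>.1 hx

theorem integral_sq_edge_le (Γ : MetricGraph V E) (g : E → ℝ → ℝ) (e : E) :
    ∫ x in 0..Γ.len e, g e x ^ 2 ≤ Γ.l2NormSq g :=
  Finset.single_le_sum (f := fun e => ∫ x in 0..Γ.len e, g e x ^ 2)
    (fun e _ => intervalIntegral.integral_nonneg (Γ.len_pos e).le fun _ _ => sq_nonneg _)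
    (Finset.mem_univ e)

theorem IsW12.abs_sub_le (hu : Γ.IsW12 u g) {e : E} {x y : ℝ} (hx : x ∈ Icc 0 (Γ.len e))
    (hy : y ∈ Icc 0 (Γ.len e)) : |u e y - u e x| ≤ √|y - x| * √(Γ.l2NormSq g) :=
  ((hu e).abs_sub_le (Γ.len_pos e) hx hy).trans <| mul_le_mul_of_nonneg_left
    (Real.sqrt_le_sqrt (Γ.integral_sq_edge_le g e)) (Real.sqrt_nonneg _)

theorem IsW12.l2Inner_add_l2Inner_eq_sum (hz : Γ.IsW12 z f) (hu : Γ.IsW12 u g) :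
    Γ.l2Inner f u + Γ.l2Inner z g = ∑ e, (z e (Γ.len e) * u e (Γ.len e) - z e 0 * u e 0) := by
  rw [l2Inner, l2Inner, integral, integral, ← Finset.sum_add_distrib]
  refine Finset.sum_congr rfl fun e _ => ?_
  rw [← (hz.isPrimitiveOn e).integral_mul_add_mul (Γ.len_pos e).le (hu.isPrimitiveOn e)]
  exact (intervalIntegral.integral_add (hz.isL2_deriv.isL1_mul hu.isL2 e)
    (hz.isL2.isL1_mul hu.isL2_deriv e)).symm

theorem kirchhoff_iff_forall_sum_eq_zero : Γ.Kirchhoff z ↔ ∀ c : V → ℝ,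
    ∑ e, (z e (Γ.len e) * c (Γ.target e) - z e 0 * c (Γ.source e)) = 0 := by
  classical
  refine ⟨fun hz c => ?_, fun hz v => ?_⟩
  · set ends := Finset.univ.image Γ.source ∪ Finset.univ.image Γ.target with hends
    calc ∑ e, (z e (Γ.len e) * c (Γ.target e) - z e 0 * c (Γ.source e))
        = ∑ e, ∑ v ∈ ends, c v * ((if Γ.target e = v then z e (Γ.len e) else 0)
            - (if Γ.source e = v then z e 0 else 0)) := by
          refine Finset.sum_congr rfl fun e _ => ?_
          simp [mul_sub, Finset.sum_sub_distrib, hends]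
          ring
      _ = 0 := by
          rw [Finset.sum_comm]
          refine Finset.sum_eq_zero fun v _ => ?_
          rw [← Finset.mul_sum, hz v, mul_zero]
  · simpa [Pi.single_apply] using hz (Pi.single v 1)

/-- Testing against the functions which are linear on the edges recovers the vertex condition. -/
theorem IsW12.kirchhoff_iff (hz : Γ.IsW12 z f) :
    Γ.Kirchhoff z ↔ ∀ p ∈ Γ.formDomain, Γ.l2Inner f p.1 + Γ.l2Inner z p.2 = 0 := by
  rw [kirchhoff_iff_forall_sum_eq_zero]
  constructor
  · rintro hsum p ⟨hp, c, hc⟩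
    simp only [hz.l2Inner_add_l2Inner_eq_sum hp, hc, hsum c]
  · intro hgreen c
    obtain ⟨p, hp, hpc⟩ := Γ.exists_mem_formDomain_of_vertexValues c
    have hsum := hgreen p hp
    rw [hz.l2Inner_add_l2Inner_eq_sum hp.1] at hsum
    simpa only [hpc] using hsum

end Integral

end MetricGraph

namespace MetricGraph

variable {V E : Type*} {Γ : MetricGraph V E}

section Poincare

theorem abs_sub_le_length_mul {c : V → ℝ} {δ : ℝ}
    (hc : ∀ e, |c (Γ.target e) - c (Γ.source e)| ≤ δ) {a b : V} (p : Γ.toSimpleGraph.Walk a b) :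
    |c a - c b| ≤ p.length * δ := by
  induction p with
  | nil => simp
  | @cons a b d hab p ih =>
    have hstep : |c a - c b| ≤ δ := by
      rw [toSimpleGraph, SimpleGraph.fromEdgeSet_adj] at hab
      obtain ⟨⟨e, he⟩, -⟩ := hab
      rcases Sym2.eq_iff.1 he with ⟨rfl, rfl⟩ | ⟨rfl, rfl⟩
      · rw [abs_sub_comm]
        exact hc e
      · exact hc e
    rw [SimpleGraph.Walk.length_cons, Nat.cast_succ]
    linarith [abs_sub_le (c a) (c b) (c d)]

variable [Fintype E]

theorem IsW12.abs_sub_le_sqrt_sum_len {u g : E → ℝ → ℝ} (hu : Γ.IsW12 u g) {e : E} {x y : ℝ}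
    (hx : x ∈ Icc 0 (Γ.len e)) (hy : y ∈ Icc 0 (Γ.len e)) :
    |u e y - u e x| ≤ √(∑ e, Γ.len e) * √(Γ.l2NormSq g) := by
  refine (hu.abs_sub_le hx hy).trans (mul_le_mul_of_nonneg_right ?_ (Real.sqrt_nonneg _))
  have hlen : Γ.len e ≤ ∑ e, Γ.len e :=
    Finset.single_le_sum (fun e _ => (Γ.len_pos e).le) (Finset.mem_univ e)
  exact Real.sqrt_le_sqrt (abs_le.2 ⟨by linarith [hx.2, hy.1], by linarith [hx.1, hy.2]⟩)

theorem exists_abs_sub_le_mul_sqrt (hΓ : Γ.toSimpleGraph.Connected) :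
    ∃ C : ℝ, 0 ≤ C ∧ ∀ p ∈ Γ.formDomain,
      ∀ e, ∀ x ∈ Icc 0 (Γ.len e), ∀ e', ∀ y ∈ Icc 0 (Γ.len e'),
        |p.1 e x - p.1 e' y| ≤ C * √(Γ.l2NormSq p.2) := by
  obtain ⟨N, hN⟩ := (finite_range fun d : E × E =>
    Γ.toSimpleGraph.dist (Γ.source d.1) (Γ.source d.2)).bddAbove
  refine ⟨(2 + N) * √(∑ e, Γ.len e), by positivity, ?_⟩
  rintro p ⟨hp, c, hc⟩ e x hx e' y hy
  set δ := √(∑ e, Γ.len e) * √(Γ.l2NormSq p.2)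
  have edge_le : ∀ e, ∀ x ∈ Icc 0 (Γ.len e), ∀ y ∈ Icc 0 (Γ.len e), |p.1 e y - p.1 e x| ≤ δ :=
    fun e x hx y hy => hp.abs_sub_le_sqrt_sum_len hx hy
  obtain ⟨walk, hwalk⟩ := hΓ.exists_walk_length_eq_dist (Γ.source e) (Γ.source e')
  have vertex_le : |p.1 e 0 - p.1 e' 0| ≤ N * δ := by
    rw [(hc e).1, (hc e').1]
    refine (abs_sub_le_length_mul (δ := δ) (fun e => ?_) walk).trans ?_
    · rw [← (hc e).1, ← (hc e).2]
      exact edge_le e _ (Γ.zero_mem_Icc e) _ (Γ.len_mem_Icc e)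
    · rw [hwalk]
      exact mul_le_mul_of_nonneg_right (Nat.cast_le.2 (hN ⟨(e, e'), rfl⟩)) (by positivity)
  calc |p.1 e x - p.1 e' y|
      = |(p.1 e x - p.1 e 0) + (p.1 e 0 - p.1 e' 0) + (p.1 e' 0 - p.1 e' y)| := by ring_nf
    _ ≤ |p.1 e x - p.1 e 0| + |p.1 e 0 - p.1 e' 0| + |p.1 e' 0 - p.1 e' y| := abs_add_three _ _ _
    _ ≤ δ + N * δ + δ := by
        gcongr
        · exact edge_le e _ (Γ.zero_mem_Icc e) _ hx
        · exact edge_le e' _ hy _ (Γ.zero_mem_Icc e')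
    _ = (2 + N) * √(∑ e, Γ.len e) * √(Γ.l2NormSq p.2) := by ring

theorem sum_len_pos [Nonempty E] (Γ : MetricGraph V E) : 0 < ∑ e, Γ.len e :=
  Finset.sum_pos (fun e _ => Γ.len_pos e) Finset.univ_nonempty

/-- The functions of the form domain with vanishing mean, paired with their derivatives. -/
def meanZeroFormDomain (Γ : MetricGraph V E) : Submodule ℝ ((E → ℝ → ℝ) × (E → ℝ → ℝ)) where
  carrier := {p | p ∈ Γ.formDomain ∧ Γ.integral p.1 = 0}
  zero_mem' := ⟨zero_mem _, by simp [integral]⟩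
  add_mem' := by
    rintro p q ⟨hp, hp0⟩ ⟨hq, hq0⟩
    exact ⟨add_mem hp hq, by
      rw [Prod.fst_add, integral_add hp.1.isL2.isL1 hq.1.isL2.isL1, hp0, hq0, add_zero]⟩
  smul_mem' := by
    rintro t p ⟨hp, hp0⟩
    exact ⟨Submodule.smul_mem _ t hp, by rw [Prod.smul_fst, integral_smul, hp0, mul_zero]⟩

theorem exists_abs_le_mul_sqrt (hΓ : Γ.toSimpleGraph.Connected) :
    ∃ C : ℝ, 0 ≤ C ∧ ∀ p ∈ Γ.meanZeroFormDomain, ∀ e, ∀ x ∈ Icc 0 (Γ.len e),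
      |p.1 e x| ≤ C * √(Γ.l2NormSq p.2) := by
  obtain ⟨C, hC, hosc⟩ := exists_abs_sub_le_mul_sqrt hΓ
  refine ⟨C, hC, ?_⟩
  rintro p ⟨hp, hmean⟩ e x hx
  have : Nonempty E := ⟨e⟩
  set B := C * √(Γ.l2NormSq p.2)
  have hint := hp.1.isL2.isL1
  have hconst : ∀ k : ℝ, Γ.IsL1 fun _ _ => k := fun k => isL1_of_continuousOn fun _ =>
    continuousOn_const
  have hlower := integral_mono (hconst (p.1 e x - B)) hint fun e' y hy => by
    linarith [(abs_le.1 (hosc p hp e x hx e' y hy)).2]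
  have hupper := integral_mono hint (hconst (p.1 e x + B)) fun e' y hy => by
    linarith [(abs_le.1 (hosc p hp e x hx e' y hy)).1]
  rw [hmean, integral_const] at hlower hupper
  exact abs_le.2 ⟨by linarith [nonneg_of_mul_nonneg_left hupper Γ.sum_len_pos],
    by linarith [nonpos_of_mul_nonpos_left hlower Γ.sum_len_pos]⟩

theorem mem_rayleighQuotients_iff {r : ℝ} : r ∈ Γ.rayleighQuotients ↔
    ∃ p ∈ Γ.meanZeroFormDomain, Γ.l2NormSq p.1 ≠ 0 ∧ r = Γ.l2NormSq p.2 / Γ.l2NormSq p.1 := by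
  constructor
  · rintro ⟨u, g, hu, hv, hne, hmean, hr⟩
    exact ⟨(u, g), ⟨⟨hu, hv⟩, hmean⟩, hne, hr⟩
  · rintro ⟨p, ⟨⟨hu, hv⟩, hmean⟩, hne, hr⟩
    exact ⟨p.1, p.2, hu, hv, hne, hmean, hr⟩

theorem zero_notMem_rayleighQuotients (hΓ : Γ.toSimpleGraph.Connected) :
    0 ∉ Γ.rayleighQuotients := by
  intro h0
  obtain ⟨p, hp, hne, hquot⟩ := mem_rayleighQuotients_iff.1 h0
  obtain ⟨C, -, hC⟩ := exists_abs_le_mul_sqrt hΓ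
  have henergy : Γ.l2NormSq p.2 = 0 := (div_eq_zero_iff.1 hquot.symm).resolve_right hne
  refine hne (le_antisymm ?_ (Γ.l2NormSq_nonneg _))
  calc Γ.l2NormSq p.1 ≤ Γ.integral fun _ _ => 0 :=
        integral_mono hp.1.1.isL2.isL1_sq (isL1_of_continuousOn fun _ => continuousOn_const)
          fun e x hx => by
            have hx0 : p.1 e x = 0 := by simpa [henergy] using hC p hp e x hx
            simp [hx0]
    _ = 0 := by simp [integral_const]

end Poincare

end MetricGraph

/-! ### Minimisation of the Rayleigh quotient -/

theorem exists_subseq_tendsto_of_equicontinuous {ι : Type*} [Countable ι] {K : ι → Type*}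
    [∀ i, TopologicalSpace (K i)] [∀ i, CompactSpace (K i)]
    {f : ℕ → ∀ i, BoundedContinuousFunction (K i) ℝ} {M : ℝ} (hM : ∀ n i x, |f n i x| ≤ M)
    (hf : ∀ i, Equicontinuous fun n => ⇑(f n i)) :
    ∃ (φ : ℕ → ℕ) (F : ∀ i, BoundedContinuousFunction (K i) ℝ),
      StrictMono φ ∧ Tendsto (f ∘ φ) atTop (𝓝 F) := by
  have hcompact := isCompact_univ_pi fun i =>
    BoundedContinuousFunction.arzela_ascoli (Icc (-M) M) isCompact_Icc (range fun n => f n i)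
      (by rintro _ x ⟨n, rfl⟩; exact abs_le.1 (hM n i x))
      (by
        intro x U hU
        filter_upwards [hf i x U hU] with y hy
        rintro ⟨_, n, rfl⟩
        exact hy n)
  obtain ⟨F, -, φ, hφ, hF⟩ := hcompact.tendsto_subseq (x := f) fun n i _ =>
    subset_closure ⟨n, rfl⟩
  exact ⟨φ, F, hφ, hF⟩

theorem exists_tendsto_integral_sub_sq {α : Type*} [MeasurableSpace α] {μ : Measure α}
    {g : ℕ → α → ℝ} (hg : ∀ n, MemLp (g n) 2 μ)
    (hcauchy : Tendsto (fun p : ℕ × ℕ => ∫ x, (g p.1 x - g p.2 x) ^ 2 ∂μ)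
      (atTop ×ˢ atTop) (𝓝 0)) :
    ∃ G, MemLp G 2 μ ∧ Tendsto (fun n => ∫ x, (g n x - G x) ^ 2 ∂μ) atTop (𝓝 0) ∧
      Tendsto (fun n => ∫ x, g n x ^ 2 ∂μ) atTop (𝓝 (∫ x, G x ^ 2 ∂μ)) := by
  have norm_sub_sq : ∀ {a b : α → ℝ} (ha : MemLp a 2 μ) (hb : MemLp b 2 μ),
      ‖ha.toLp a - hb.toLp b‖ ^ 2 = ∫ x, (a x - b x) ^ 2 ∂μ := fun ha hb => by
    rw [← MemLp.toLp_sub, norm_toLp_sq]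
    rfl
  have hseq : CauchySeq fun n => (hg n).toLp (g n) := by
    rw [cauchySeq_iff_tendsto_dist_atTop_0, ← prod_atTop_atTop_eq]
    simpa only [Function.comp_def, ← norm_sub_sq (hg _) (hg _), Real.sqrt_sq (norm_nonneg _),
      dist_eq_norm, Real.sqrt_zero] using (Real.continuous_sqrt.tendsto 0).comp hcauchy
  obtain ⟨F, hF⟩ := cauchySeq_tendsto_of_complete hseq
  have hFmem := Lp.memLp F
  rw [← Lp.toLp_coeFn F hFmem] at hF
  refine ⟨F, hFmem, ?_, ?_⟩
  · simpa only [norm_sub_sq (hg _) hFmem, zero_pow two_ne_zero] using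
      (tendsto_iff_norm_sub_tendsto_zero.1 hF).pow 2
  · simpa only [norm_toLp_sq] using hF.norm.pow 2

/-- The witness `x (L - x) (L - 2x)` vanishes at both ends and is odd about the midpoint. -/
theorem exists_hasDerivAt_integral_eq_zero {L : ℝ} (hL : 0 < L) :
    ∃ b b' : ℝ → ℝ, (∀ x, HasDerivAt b (b' x) x) ∧ Continuous b' ∧ b 0 = 0 ∧ b L = 0 ∧
      ∫ x in 0..L, b x = 0 ∧ ∫ x in 0..L, b x ^ 2 ≠ 0 := by
  refine ⟨fun x => x * (L - x) * (L - 2 * x), fun x => L ^ 2 - 6 * L * x + 6 * x ^ 2,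
    fun x => ?_, by fun_prop, by simp, by simp, ?_, ?_⟩
  · convert! ((hasDerivAt_id' x).mul ((hasDerivAt_id' x).const_sub L)).mul
      (((hasDerivAt_id' x).const_mul 2).const_sub L) using 1
    simp only [Pi.mul_apply]
    ring
  · rw [intervalIntegral.integral_eq_sub_of_hasDerivAt
      (f := fun x => (x * (L - x)) ^ 2 / 2) (fun x _ => ?_)
      (Continuous.intervalIntegrable (by fun_prop) _ _)]
    · simp
    · convert! (((hasDerivAt_id' x).mul ((hasDerivAt_id' x).const_sub L)).pow 2).div_const 2
        using 1
      simp only [Pi.mul_apply]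
      ring
  · refine (intervalIntegral.integral_pos hL (by fun_prop) (fun x _ => sq_nonneg _)
      ⟨L / 4, ⟨by linarith, by linarith⟩, ?_⟩).ne'
    have hquarter : L / 4 * (L - L / 4) * (L - 2 * (L / 4)) = 3 / 32 * L ^ 3 := by ring
    rw [hquarter]
    positivity

namespace MetricGraph

variable {V E : Type*} {Γ : MetricGraph V E}

section DirectMethod

theorem continuousAtVertices_of_tendsto [Finite E] {u : ℕ → E → ℝ → ℝ} {U : E → ℝ → ℝ}
    (hu : ∀ n, Γ.ContinuousAtVertices (u n))
    (hU : ∀ e, ∀ x ∈ Icc 0 (Γ.len e), Tendsto (fun n => u n e x) atTop (𝓝 (U e x))) :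
    Γ.ContinuousAtVertices U := by
  let ends : (V → ℝ) →ₗ[ℝ] (E → ℝ) × (E → ℝ) :=
    (LinearMap.funLeft ℝ ℝ Γ.source).prod (LinearMap.funLeft ℝ ℝ Γ.target)
  have hclosed : IsClosed (LinearMap.range ends : Set ((E → ℝ) × (E → ℝ))) :=
    Submodule.closed_of_finiteDimensional _
  have hlim : Tendsto (fun n => (fun e => u n e 0, fun e => u n e (Γ.len e))) atTop
      (𝓝 (fun e => U e 0, fun e => U e (Γ.len e))) :=
    (tendsto_pi_nhds.2 fun e => hU e 0 (Γ.zero_mem_Icc e)).prodMk_nhds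
      (tendsto_pi_nhds.2 fun e => hU e _ (Γ.len_mem_Icc e))
  obtain ⟨c, hc⟩ := hclosed.mem_of_tendsto hlim (.of_forall fun n => by
    obtain ⟨c, hc⟩ := hu n
    exact ⟨c, Prod.ext (funext fun e => (hc e).1.symm) (funext fun e => (hc e).2.symm)⟩)
  exact ⟨c, fun e => ⟨(congrFun (congrArg Prod.fst hc) e).symm,
    (congrFun (congrArg Prod.snd hc) e).symm⟩⟩

variable [Fintype E]

theorem tendsto_integral_of_bounded {ι : Type*} {l : Filter ι} [l.IsCountablyGenerated]
    {f : ι → E → ℝ → ℝ} {F : E → ℝ → ℝ} {B : ℝ}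
    (hf : ∀ i e, ContinuousOn (f i e) (Icc 0 (Γ.len e)))
    (hB : ∀ i e, ∀ x ∈ Icc 0 (Γ.len e), |f i e x| ≤ B)
    (hF : ∀ e, ∀ x ∈ Icc 0 (Γ.len e), Tendsto (fun i => f i e x) l (𝓝 (F e x))) :
    Tendsto (fun i => Γ.integral (f i)) l (𝓝 (Γ.integral F)) := by
  refine tendsto_finsetSum _ fun e _ => ?_
  have hsub : uIoc 0 (Γ.len e) ⊆ Icc 0 (Γ.len e) := by
    rw [uIoc_of_le (Γ.len_pos e).le]
    exact Ioc_subset_Icc_self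
  exact intervalIntegral.tendsto_integral_filter_of_dominated_convergence (fun _ => B)
    (.of_forall fun i => ((hf i e).mono hsub).aestronglyMeasurable measurableSet_uIoc)
    (.of_forall fun i => ae_of_all _ fun x hx => hB i e x (hsub hx)) (by simp)
    (ae_of_all _ fun x hx => hF e x (hsub hx))

theorem exists_subseq_tendsto_of_l2NormSq_le {u g : ℕ → E → ℝ → ℝ} {M R : ℝ}
    (hu : ∀ n, Γ.IsW12 (u n) (g n)) (hM : ∀ n e, ∀ x ∈ Icc 0 (Γ.len e), |u n e x| ≤ M)
    (hR : ∀ n, Γ.l2NormSq (g n) ≤ R) :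
    ∃ (φ : ℕ → ℕ) (U : E → ℝ → ℝ), StrictMono φ ∧
      ∀ e, ∀ x ∈ Icc 0 (Γ.len e), Tendsto (fun n => u (φ n) e x) atTop (𝓝 (U e x)) := by
  let f : ℕ → ∀ e, BoundedContinuousFunction (Icc 0 (Γ.len e)) ℝ := fun n e =>
    .mkOfCompact ⟨_, (hu n e).continuousOn.domRestrict⟩
  have hmodulus : Tendsto (fun t => √t * √R) (𝓝 0) (𝓝 0) := by
    have hcont : Continuous fun t => √t * √R := by fun_prop
    simpa using hcont.tendsto 0
  have hequi : ∀ e, Equicontinuous fun n => ⇑(f n e) := fun e =>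
    Metric.equicontinuous_of_continuity_modulus _ hmodulus _ fun x y n =>
      ((hu n).abs_sub_le y.2 x.2).trans <| mul_le_mul_of_nonneg_left (Real.sqrt_le_sqrt (hR n))
        (Real.sqrt_nonneg _)
  obtain ⟨φ, F, hφ, hF⟩ := exists_subseq_tendsto_of_equicontinuous (f := f)
    (fun n e x => hM n e x x.2) hequi
  refine ⟨φ, fun e => IccExtend (Γ.len_pos e).le (F e), hφ, fun e x hx => ?_⟩
  simp only [IccExtend_of_mem _ _ hx]
  exact ((continuous_eval_const (⟨x, hx⟩ : Icc 0 (Γ.len e))).tendsto (F e)).comp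
    (tendsto_pi_nhds.1 hF e)

theorem exists_tendsto_l2NormSq_sub {g : ℕ → E → ℝ → ℝ} (hg : ∀ n, Γ.IsL2 (g n))
    (hcauchy : Tendsto (fun p : ℕ × ℕ => Γ.l2NormSq (g p.1 - g p.2)) (atTop ×ˢ atTop) (𝓝 0)) :
    ∃ G, Γ.IsL2 G ∧ Tendsto (fun n => Γ.l2NormSq (g n - G)) atTop (𝓝 0) ∧
      Tendsto (fun n => Γ.l2NormSq (g n)) atTop (𝓝 (Γ.l2NormSq G)) := by
  have edge_eq : ∀ (e : E) (v : ℝ → ℝ),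
      ∫ x in Ioo 0 (Γ.len e), v x = ∫ x in 0..Γ.len e, v x := fun e v => by
    rw [intervalIntegral.integral_of_le (Γ.len_pos e).le, restrict_Ioo_eq_restrict_Ioc]
  have edge_cauchy : ∀ e, Tendsto (fun p : ℕ × ℕ =>
      ∫ x in Ioo 0 (Γ.len e), (g p.1 e x - g p.2 e x) ^ 2) (atTop ×ˢ atTop) (𝓝 0) := fun e => by
    refine squeeze_zero (fun p => integral_nonneg fun _ => sq_nonneg _) (fun p => ?_) hcauchy
    rw [edge_eq]
    exact Γ.integral_sq_edge_le (g p.1 - g p.2) e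
  choose G hG hsub hsq using fun e =>
    exists_tendsto_integral_sub_sq (fun n => hg n e) (edge_cauchy e)
  simp only [edge_eq] at hsub hsq
  refine ⟨G, hG, ?_, tendsto_finsetSum _ fun e _ => hsq e⟩
  have hsum := tendsto_finsetSum Finset.univ fun e _ => hsub e
  rwa [Finset.sum_const_zero] at hsum

theorem IsL2.abs_integral_le {h : E → ℝ → ℝ} (hh : Γ.IsL2 h) {e : E} {x : ℝ}
    (hx : x ∈ Icc 0 (Γ.len e)) : |∫ t in 0..x, h e t| ≤ √x * √(Γ.l2NormSq h) := by
  have hprim : Γ.IsW12 (fun e y => 0 + ∫ t in 0..y, h e t) h :=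
    isW12_iff.2 ⟨fun e => .const_add_integral (hh.isL1 e) 0, hh⟩
  simpa [abs_of_nonneg hx.1] using hprim.abs_sub_le (Γ.zero_mem_Icc e) hx

theorem mem_formDomain_of_tendsto {p : ℕ → (E → ℝ → ℝ) × (E → ℝ → ℝ)} {U G : E → ℝ → ℝ}
    (hp : ∀ n, p n ∈ Γ.formDomain)
    (hU : ∀ e, ∀ x ∈ Icc 0 (Γ.len e), Tendsto (fun n => (p n).1 e x) atTop (𝓝 (U e x)))
    (hG : Γ.IsL2 G) (hpG : Tendsto (fun n => Γ.l2NormSq ((p n).2 - G)) atTop (𝓝 0)) :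
    (U, G) ∈ Γ.formDomain := by
  refine ⟨isW12_iff.2 ⟨fun e => ⟨hG.isL1 e, fun x hx => ?_⟩, hG⟩,
    continuousAtVertices_of_tendsto (fun n => (hp n).2) hU⟩
  have hsub : Tendsto (fun n => ∫ t in 0..x, ((p n).2 - G) e t) atTop (𝓝 0) := by
    refine squeeze_zero_norm (fun n => ((hp n).1.isL2_deriv.sub hG).abs_integral_le hx) ?_
    simpa using ((Real.continuous_sqrt.tendsto 0).comp hpG).const_mul √x
  refine tendsto_nhds_unique (hU e x hx) ?_
  have hlim := ((hU e 0 (Γ.zero_mem_Icc e)).add hsub).add_const (∫ t in 0..x, G e t)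
  rw [add_zero] at hlim
  refine hlim.congr fun n => ?_
  have hprim := (hp n).1.isPrimitiveOn e
  have hn := hprim.intervalIntegrable_of_mem (Γ.zero_mem_Icc e) hx
  have hGx := (IsPrimitiveOn.const_add_integral (hG.isL1 e) 0).intervalIntegrable_of_mem
    (Γ.zero_mem_Icc e) hx
  rw [hprim.eq_add_integral x hx]
  simp only [Pi.sub_apply]
  rw [intervalIntegral.integral_sub hn hGx]
  ring

theorem mul_l2NormSq_le_of_mem_lowerBounds {lam : ℝ}
    (hlam : lam ∈ lowerBounds Γ.rayleighQuotients) {p : (E → ℝ → ℝ) × (E → ℝ → ℝ)}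
    (hp : p ∈ Γ.meanZeroFormDomain) : lam * Γ.l2NormSq p.1 ≤ Γ.l2NormSq p.2 := by
  rcases (Γ.l2NormSq_nonneg p.1).eq_or_lt with hzero | hpos
  · rw [← hzero, mul_zero]
    exact Γ.l2NormSq_nonneg _
  · rw [← le_div_iff₀ hpos]
    exact hlam (mem_rayleighQuotients_iff.2 ⟨p, hp, hpos.ne', rfl⟩)

theorem integral_single [DecidableEq E] (Γ : MetricGraph V E) (e : E) (v : ℝ → ℝ) :
    Γ.integral (Pi.single e v) = ∫ x in 0..Γ.len e, v x := by
  rw [integral, Finset.sum_eq_single e (by simp +contextual) (by simp), Pi.single_eq_same]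

theorem rayleighQuotients_nonempty [Nonempty E] (Γ : MetricGraph V E) :
    Γ.rayleighQuotients.Nonempty := by
  classical
  obtain ⟨e₀⟩ := ‹Nonempty E›
  obtain ⟨b, b', hb, hb', hb0, hbL, hmean, hsq⟩ :=
    exists_hasDerivAt_integral_eq_zero (Γ.len_pos e₀)
  have hmem : (Pi.single e₀ b, Pi.single e₀ b') ∈ Γ.formDomain := by
    refine mem_formDomain_of_hasDerivAt (fun e x => ?_) (fun e => ?_) ⟨0, fun e => ?_⟩ <;>
      rcases eq_or_ne e e₀ with rfl | he
    · simpa using hb x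
    · simp [he]
    · simpa using hb'
    · simp [he, continuous_zero]
    · simp [hb0, hbL]
    · simp [he]
  have hsingle : (fun e x => (Pi.single e₀ b : E → ℝ → ℝ) e x ^ 2)
      = Pi.single e₀ fun x => b x ^ 2 := by
    ext e x
    rcases eq_or_ne e e₀ with rfl | he
    · simp
    · simp [he]
  refine ⟨_, mem_rayleighQuotients_iff.2 ⟨_, ⟨hmem, ?_⟩, ?_, rfl⟩⟩
  · rw [integral_single, hmean]
  · rwa [l2NormSq, hsingle, integral_single]

theorem l2NormSq_sub_le_of_mem_lowerBounds {lam : ℝ} (hlam : lam ∈ lowerBounds Γ.rayleighQuotients)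
    {p q : (E → ℝ → ℝ) × (E → ℝ → ℝ)} (hp : p ∈ Γ.meanZeroFormDomain)
    (hq : q ∈ Γ.meanZeroFormDomain) :
    Γ.l2NormSq (p.2 - q.2) ≤ lam * Γ.l2NormSq (p.1 - q.1)
      + 2 * (Γ.l2NormSq p.2 - lam * Γ.l2NormSq p.1)
      + 2 * (Γ.l2NormSq q.2 - lam * Γ.l2NormSq q.1) := by
  have hadd := mul_l2NormSq_le_of_mem_lowerBounds hlam (add_mem hp hq)
  have hvalues := l2NormSq_add_add_l2NormSq_sub hp.1.1.isL2 hq.1.1.isL2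
  have hderivs := l2NormSq_add_add_l2NormSq_sub hp.1.1.isL2_deriv hq.1.1.isL2_deriv
  rw [Prod.fst_add, Prod.snd_add] at hadd
  linear_combination hadd - lam * hvalues + hderivs

theorem exists_normalized_of_mem_rayleighQuotients {r : ℝ} (hr : r ∈ Γ.rayleighQuotients) :
    ∃ p ∈ Γ.meanZeroFormDomain, Γ.l2NormSq p.1 = 1 ∧ Γ.l2NormSq p.2 = r := by
  obtain ⟨p, hp, hne, rfl⟩ := mem_rayleighQuotients_iff.1 hr
  have hscale : (√(Γ.l2NormSq p.1))⁻¹ ^ 2 = (Γ.l2NormSq p.1)⁻¹ := by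
    rw [inv_pow, Real.sq_sqrt (Γ.l2NormSq_nonneg _)]
  refine ⟨(√(Γ.l2NormSq p.1))⁻¹ • p, Submodule.smul_mem _ _ hp, ?_, ?_⟩
  · rw [Prod.smul_fst, l2NormSq_smul, hscale, inv_mul_cancel₀ hne]
  · rw [Prod.smul_snd, l2NormSq_smul, hscale, inv_mul_eq_div]

section PointwiseLimit

variable {u : ℕ → E → ℝ → ℝ} {U : E → ℝ → ℝ} {M : ℝ}

theorem tendsto_l2NormSq_of_bounded (hu : ∀ n e, ContinuousOn (u n e) (Icc 0 (Γ.len e)))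
    (hM : ∀ n e, ∀ x ∈ Icc 0 (Γ.len e), |u n e x| ≤ M)
    (hU : ∀ e, ∀ x ∈ Icc 0 (Γ.len e), Tendsto (fun n => u n e x) atTop (𝓝 (U e x))) :
    Tendsto (fun n => Γ.l2NormSq (u n)) atTop (𝓝 (Γ.l2NormSq U)) :=
  tendsto_integral_of_bounded (B := M ^ 2) (fun n e => (hu n e).pow 2)
    (fun n e x hx => (abs_pow _ _).trans_le
      (pow_le_pow_left₀ (abs_nonneg _) (hM n e x hx) 2))
    fun e x hx => (hU e x hx).pow 2

theorem tendsto_l2NormSq_sub_of_bounded (hu : ∀ n e, ContinuousOn (u n e) (Icc 0 (Γ.len e)))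
    (hM : ∀ n e, ∀ x ∈ Icc 0 (Γ.len e), |u n e x| ≤ M)
    (hU : ∀ e, ∀ x ∈ Icc 0 (Γ.len e), Tendsto (fun n => u n e x) atTop (𝓝 (U e x))) :
    Tendsto (fun k : ℕ × ℕ => Γ.l2NormSq (u k.1 - u k.2)) (atTop ×ˢ atTop) (𝓝 0) := by
  have hlim : Tendsto (fun k : ℕ × ℕ => Γ.l2NormSq (u k.1 - u k.2)) (atTop ×ˢ atTop)
      (𝓝 (Γ.integral fun _ _ => 0)) :=
    tendsto_integral_of_bounded (B := (M + M) ^ 2)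
      (fun k e => ((hu k.1 e).sub (hu k.2 e)).pow 2)
      (fun k e x hx => (abs_pow _ _).trans_le (pow_le_pow_left₀ (abs_nonneg _)
        ((abs_sub _ _).trans (add_le_add (hM _ e x hx) (hM _ e x hx))) 2))
      fun e x hx => by
        simpa using (((hU e x hx).comp tendsto_fst).sub ((hU e x hx).comp tendsto_snd)).pow 2
  simpa [integral_const] using hlim

end PointwiseLimit

theorem tendsto_l2NormSq_deriv_sub {lam : ℝ} (hlam : lam ∈ lowerBounds Γ.rayleighQuotients)
    {p : ℕ → (E → ℝ → ℝ) × (E → ℝ → ℝ)} (hp : ∀ n, p n ∈ Γ.meanZeroFormDomain)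
    (hvalues : ∀ n, Γ.l2NormSq (p n).1 = 1)
    (hderivs : Tendsto (fun n => Γ.l2NormSq (p n).2) atTop (𝓝 lam))
    (hcauchy : Tendsto (fun k : ℕ × ℕ => Γ.l2NormSq ((p k.1).1 - (p k.2).1)) (atTop ×ˢ atTop)
      (𝓝 0)) :
    Tendsto (fun k : ℕ × ℕ => Γ.l2NormSq ((p k.1).2 - (p k.2).2)) (atTop ×ˢ atTop) (𝓝 0) := by
  have hexcess : Tendsto (fun n => 2 * (Γ.l2NormSq (p n).2 - lam * Γ.l2NormSq (p n).1)) atTop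
      (𝓝 0) := by
    simpa [hvalues] using (hderivs.sub_const lam).const_mul 2
  refine squeeze_zero (fun k => Γ.l2NormSq_nonneg _)
    (fun k => l2NormSq_sub_le_of_mem_lowerBounds hlam (hp k.1) (hp k.2)) ?_
  simpa only [mul_zero, add_zero, Function.comp_def] using
    ((hcauchy.const_mul lam).add (hexcess.comp tendsto_fst)).add (hexcess.comp tendsto_snd)

theorem mem_rayleighQuotients_of_minimizing {lam M : ℝ}
    (hlam : lam ∈ lowerBounds Γ.rayleighQuotients) {p : ℕ → (E → ℝ → ℝ) × (E → ℝ → ℝ)}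
    {U : E → ℝ → ℝ} (hp : ∀ n, p n ∈ Γ.meanZeroFormDomain)
    (hvalues : ∀ n, Γ.l2NormSq (p n).1 = 1)
    (hderivs : Tendsto (fun n => Γ.l2NormSq (p n).2) atTop (𝓝 lam))
    (hM : ∀ n e, ∀ x ∈ Icc 0 (Γ.len e), |(p n).1 e x| ≤ M)
    (hU : ∀ e, ∀ x ∈ Icc 0 (Γ.len e), Tendsto (fun n => (p n).1 e x) atTop (𝓝 (U e x))) :
    lam ∈ Γ.rayleighQuotients := by
  have hcont : ∀ n e, ContinuousOn ((p n).1 e) (Icc 0 (Γ.len e)) := fun n e =>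
    ((hp n).1.1 e).continuousOn
  have hcauchy := tendsto_l2NormSq_deriv_sub hlam hp hvalues hderivs
    (tendsto_l2NormSq_sub_of_bounded (u := fun n => (p n).1) hcont hM hU)
  obtain ⟨G, hG, hsub, hsq⟩ := exists_tendsto_l2NormSq_sub (g := fun n => (p n).2)
    (fun n => (hp n).1.1.isL2_deriv) hcauchy
  have hmean : Γ.integral U = 0 := tendsto_nhds_unique
    (tendsto_integral_of_bounded hcont hM hU)
    (tendsto_const_nhds.congr fun n => (hp n).2.symm)
  have hUsq : Γ.l2NormSq U = 1 := tendsto_nhds_unique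
    (tendsto_l2NormSq_of_bounded hcont hM hU)
    (tendsto_const_nhds.congr fun n => (hvalues n).symm)
  have hGsq : Γ.l2NormSq G = lam := tendsto_nhds_unique hsq hderivs
  exact mem_rayleighQuotients_iff.2 ⟨(U, G),
    ⟨mem_formDomain_of_tendsto (fun n => (hp n).1) hU hG hsub, hmean⟩,
    by simp [hUsq], by simp [hUsq, hGsq]⟩

theorem mem_rayleighQuotients_of_tendsto (hΓ : Γ.toSimpleGraph.Connected) {lam : ℝ}
    (hlam : lam ∈ lowerBounds Γ.rayleighQuotients) {r : ℕ → ℝ} (hr : Tendsto r atTop (𝓝 lam))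
    (hrmem : ∀ n, r n ∈ Γ.rayleighQuotients) : lam ∈ Γ.rayleighQuotients := by
  choose p hp hvalues hderivs using fun n => exists_normalized_of_mem_rayleighQuotients (hrmem n)
  obtain ⟨R, hR⟩ := hr.bddAbove_range
  have hRle : ∀ n, Γ.l2NormSq (p n).2 ≤ R := fun n => (hderivs n).trans_le (hR ⟨n, rfl⟩)
  obtain ⟨C, hC, hsup⟩ := exists_abs_le_mul_sqrt hΓ
  have hM : ∀ n e, ∀ x ∈ Icc 0 (Γ.len e), |(p n).1 e x| ≤ C * √R := fun n e x hx =>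
    (hsup _ (hp n) e x hx).trans (mul_le_mul_of_nonneg_left (Real.sqrt_le_sqrt (hRle n)) hC)
  obtain ⟨φ, U, hφ, hU⟩ := exists_subseq_tendsto_of_l2NormSq_le (fun n => (hp n).1.1) hM hRle
  have henergy : Tendsto (fun n => Γ.l2NormSq (p (φ n)).2) atTop (𝓝 lam) := by
    simpa only [hderivs, Function.comp_def] using hr.comp hφ.tendsto_atTop
  exact mem_rayleighQuotients_of_minimizing (p := fun n => p (φ n)) hlam (fun n => hp (φ n))
    (fun n => hvalues (φ n)) henergy (fun n => hM (φ n)) hU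

theorem exists_isLeast_rayleighQuotients [Nonempty E] (hΓ : Γ.toSimpleGraph.Connected) :
    ∃ lam, IsLeast Γ.rayleighQuotients lam := by
  have hbdd : BddBelow Γ.rayleighQuotients := ⟨0, fun r hr => by
    obtain ⟨p, -, -, rfl⟩ := mem_rayleighQuotients_iff.1 hr
    exact div_nonneg (Γ.l2NormSq_nonneg _) (Γ.l2NormSq_nonneg _)⟩
  obtain ⟨r, -, hr, hrmem⟩ := exists_seq_tendsto_sInf Γ.rayleighQuotients_nonempty hbdd
  have hlower : sInf Γ.rayleighQuotients ∈ lowerBounds Γ.rayleighQuotients := fun s hs =>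
    csInf_le hbdd hs
  exact ⟨_, mem_rayleighQuotients_of_tendsto hΓ hlower hr hrmem, hlower⟩

end DirectMethod

end MetricGraph

/-! ### The eigenvalue equation -/

theorem eq_zero_of_forall_mul_add_sq_mul_nonneg {a b : ℝ} (h : ∀ t : ℝ, 0 ≤ t * b + t ^ 2 * a) :
    b = 0 := by
  have hdiscrim : discrim a b 0 ≤ 0 := discrim_le_zero fun t => by linarith [h t]
  rw [discrim] at hdiscrim
  exact pow_eq_zero_iff two_ne_zero |>.1 (le_antisymm (by linarith) (sq_nonneg b))

namespace MetricGraph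

section EulerLagrange

variable {V E : Type*} {Γ : MetricGraph V E} {u f g : E → ℝ → ℝ}

theorem exists_isW12_sub_mean_zero (hg : Γ.IsL2 g) (hf : Γ.IsL2 f) :
    ∃ G, Γ.IsW12 G f ∧ ∀ e, ∫ x in 0..Γ.len e, (g - G) e x = 0 := by
  have hF : ∀ e, ContinuousOn (fun x => 0 + ∫ t in 0..x, f e t) (Icc 0 (Γ.len e)) := fun e =>
    (IsPrimitiveOn.const_add_integral (hf.isL1 e) 0).continuousOn (Γ.len_pos e).le
  refine ⟨fun e x => (∫ y in 0..Γ.len e, (g e y - (0 + ∫ t in 0..y, f e t))) / Γ.len e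
      + ∫ t in 0..x, f e t, isW12_iff.2 ⟨fun e => .const_add_integral (hf.isL1 e) _, hf⟩,
    fun e => ?_⟩
  have hFint := (hF e).intervalIntegrable_of_Icc (μ := volume) (Γ.len_pos e).le
  simp only [zero_add] at hFint ⊢
  simp only [Pi.sub_apply, ← sub_sub, sub_right_comm (g e _)]
  rw [intervalIntegral.integral_sub ((hg.isL1 e).sub hFint) intervalIntegrable_const,
    intervalIntegral.integral_const, smul_eq_mul, sub_zero,
    mul_div_cancel₀ _ (Γ.len_pos e).ne', sub_self]

variable [Fintype E] {p q : (E → ℝ → ℝ) × (E → ℝ → ℝ)} {lam μ : ℝ}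

theorem l2Inner_congr_ae_left (hfg : ∀ e, f e =ᵐ[volume.restrict (Ioo 0 (Γ.len e))] g e)
    (u : E → ℝ → ℝ) : Γ.l2Inner f u = Γ.l2Inner g u :=
  integral_congr_ae fun e => (hfg e).mul (ae_eq_refl (u e))

/-- Du Bois-Reymond: the test functions are the primitives, vanishing at the vertices, of the
difference between the weak derivative and a primitive of the right-hand side. -/
theorem isLaplacian_of_forall_formDomain (hp : p ∈ Γ.formDomain) (hf : Γ.IsL2 f)
    (hweak : ∀ q ∈ Γ.formDomain, Γ.l2Inner f q.1 + Γ.l2Inner p.2 q.2 = 0) :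
    Γ.IsLaplacian p.1 f := by
  obtain ⟨G, hG, hmean⟩ := exists_isW12_sub_mean_zero hp.1.isL2_deriv hf
  have hdiff : Γ.IsL2 (p.2 - G) := hp.1.isL2_deriv.sub hG.isL2
  have htest := primitive_mem_formDomain hdiff hmean
  have hgreen := hG.l2Inner_add_l2Inner_eq_sum htest.1
  simp only [hmean, intervalIntegral.integral_same, mul_zero, sub_zero,
    Finset.sum_const_zero] at hgreen
  have hsplit := l2Inner_add_left hdiff hG.isL2 hdiff
  rw [sub_add_cancel, ← l2NormSq_eq_l2Inner] at hsplit
  have hae : ∀ e, p.2 e =ᵐ[volume.restrict (Ioo 0 (Γ.len e))] G e := fun e => by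
    filter_upwards [ae_eq_zero_of_l2NormSq_eq_zero hdiff
      (by linarith [hweak _ htest]) e] with x hx
    exact sub_eq_zero.1 hx
  refine ⟨G, hp.1.congr_deriv hae, hG, hp.2, hG.kirchhoff_iff.2 fun q hq => ?_⟩
  rw [← l2Inner_congr_ae_left hae]
  exact hweak q hq

theorem l2Inner_deriv_eq_mul_l2Inner (hg : Γ.IsW12 g f) (hk : Γ.Kirchhoff g)
    (hf : ∀ e, ∀ᵐ x ∂volume.restrict (Ioo 0 (Γ.len e)), -f e x = μ * u e x)
    (hq : q ∈ Γ.formDomain) : Γ.l2Inner g q.2 = μ * Γ.l2Inner u q.1 := by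
  have hfu : ∀ e, f e =ᵐ[volume.restrict (Ioo 0 (Γ.len e))] (-μ • u) e := fun e => by
    filter_upwards [hf e] with x hx
    simp only [Pi.smul_apply, smul_eq_mul]
    linarith
  have hgreen := hg.kirchhoff_iff.1 hk q hq
  rw [l2Inner_congr_ae_left hfu, l2Inner_smul_left] at hgreen
  linarith

theorem isEigenvalue_iff : Γ.IsEigenvalue μ ↔ ∃ p ∈ Γ.formDomain, Γ.l2NormSq p.1 ≠ 0 ∧
    ∀ q ∈ Γ.formDomain, Γ.l2Inner p.2 q.2 = μ * Γ.l2Inner p.1 q.1 := by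
  constructor
  · rintro ⟨u, f, ⟨g, hu, hg, hv, hk⟩, hne, hf⟩
    exact ⟨(u, g), ⟨hu, hv⟩, hne, fun q hq => l2Inner_deriv_eq_mul_l2Inner hg hk hf hq⟩
  · rintro ⟨p, hp, hne, hweak⟩
    refine ⟨p.1, -μ • p.1, isLaplacian_of_forall_formDomain hp (hp.1.isL2.const_smul _)
      fun q hq => ?_, hne, fun e => ae_of_all _ fun x => by simp⟩
    rw [l2Inner_smul_left, hweak q hq]
    ring

theorem integral_eq_zero_of_forall_l2Inner_eq (hμ : μ ≠ 0)
    (hweak : ∀ q ∈ Γ.formDomain, Γ.l2Inner g q.2 = μ * Γ.l2Inner u q.1) : Γ.integral u = 0 := by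
  have hone := hweak _ (Γ.const_mem_formDomain 1)
  simpa [l2Inner, integral_const, hμ] using hone.symm

theorem nonzeroEigenvalues_subset_rayleighQuotients (Γ : MetricGraph V E) :
    Γ.nonzeroEigenvalues ⊆ Γ.rayleighQuotients := by
  rintro μ ⟨hμ, heig⟩
  obtain ⟨p, hp, hne, hweak⟩ := isEigenvalue_iff.1 heig
  refine mem_rayleighQuotients_iff.2
    ⟨p, ⟨hp, integral_eq_zero_of_forall_l2Inner_eq hμ hweak⟩, hne, ?_⟩
  rw [l2NormSq_eq_l2Inner, hweak p hp, ← l2NormSq_eq_l2Inner, mul_div_cancel_right₀ _ hne]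

theorem l2Inner_eq_of_mem_meanZeroFormDomain (hlam : lam ∈ lowerBounds Γ.rayleighQuotients)
    (hp : p ∈ Γ.meanZeroFormDomain) (hmin : Γ.l2NormSq p.2 = lam * Γ.l2NormSq p.1)
    (hq : q ∈ Γ.meanZeroFormDomain) : Γ.l2Inner p.2 q.2 = lam * Γ.l2Inner p.1 q.1 := by
  have hzero : 2 * (Γ.l2Inner p.2 q.2 - lam * Γ.l2Inner p.1 q.1) = 0 :=
    eq_zero_of_forall_mul_add_sq_mul_nonneg (a := Γ.l2NormSq q.2 - lam * Γ.l2NormSq q.1)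
      fun t => by
        have hle := mul_l2NormSq_le_of_mem_lowerBounds hlam (add_mem hp (Submodule.smul_mem _ t hq))
        rw [Prod.fst_add, Prod.snd_add, Prod.smul_fst, Prod.smul_snd,
          l2NormSq_add_smul hp.1.1.isL2 hq.1.1.isL2,
          l2NormSq_add_smul hp.1.1.isL2_deriv hq.1.1.isL2_deriv, hmin] at hle
        linarith
  linarith

theorem exists_sub_const_mem_meanZeroFormDomain [Nonempty E] (hq : q ∈ Γ.formDomain) :
    ∃ m : ℝ, (q.1 + fun _ _ => m, q.2) ∈ Γ.meanZeroFormDomain := by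
  have hlen := Γ.sum_len_pos.ne'
  refine ⟨-Γ.integral q.1 / ∑ e, Γ.len e, ?_, ?_⟩
  · have hadd := add_mem hq (Γ.const_mem_formDomain (-Γ.integral q.1 / ∑ e, Γ.len e))
    rwa [← Prod.mk.eta (p := q), Prod.mk_add_mk, add_zero] at hadd
  · rw [integral_add hq.1.isL2.isL1 (isL1_of_continuousOn fun _ => continuousOn_const),
      integral_const, div_mul_cancel₀ _ hlen, add_neg_cancel]

theorem isEigenvalue_of_isLeast_rayleighQuotients [Nonempty E]
    (hlam : IsLeast Γ.rayleighQuotients lam) : Γ.IsEigenvalue lam := by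
  obtain ⟨p, hp, hne, hquot⟩ := mem_rayleighQuotients_iff.1 hlam.1
  refine isEigenvalue_iff.2 ⟨p, hp.1, hne, fun q hq => ?_⟩
  obtain ⟨m, hm⟩ := exists_sub_const_mem_meanZeroFormDomain hq
  have hconst : Γ.l2Inner (fun _ _ => m) p.1 = 0 := by
    have hmean : Γ.integral p.1 = 0 := hp.2
    have hsmul := Γ.integral_smul m p.1
    rwa [hmean, mul_zero] at hsmul
  have hweak := l2Inner_eq_of_mem_meanZeroFormDomain hlam.2 hp
    ((eq_div_iff hne).1 hquot).symm hm
  rwa [l2Inner_comm Γ p.1, l2Inner_add_left hq.1.isL2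
    (isL2_of_continuousOn fun _ => continuousOn_const) hp.1.1.isL2, hconst, add_zero,
    l2Inner_comm Γ q.1] at hweak

theorem isLeast_nonzeroEigenvalues_of_isLeast_rayleighQuotients [Nonempty E]
    (hΓ : Γ.toSimpleGraph.Connected) (hlam : IsLeast Γ.rayleighQuotients lam) :
    IsLeast Γ.nonzeroEigenvalues lam :=
  ⟨⟨ne_of_mem_of_not_mem hlam.1 (zero_notMem_rayleighQuotients hΓ),
    isEigenvalue_of_isLeast_rayleighQuotients hlam⟩,
    fun _ hμ => hlam.2 (Γ.nonzeroEigenvalues_subset_rayleighQuotients hμ)⟩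

end EulerLagrange

end MetricGraph

/-! ### Medians and integrals of tails -/

theorem isOpen_setOf_lt_measure_prodMk_left_preimage {X Y : Type*} [TopologicalSpace X]
    [TopologicalSpace Y] [MeasurableSpace Y] (ν : Measure Y) [ν.Regular] (c : ℝ≥0∞)
    {U : Set (X × Y)} (hU : IsOpen U) : IsOpen {x | c < ν (Prod.mk x ⁻¹' U)} := by
  refine isOpen_iff_mem_nhds.2 fun x hx => ?_
  obtain ⟨K, hKU, hK, hcK⟩ := (hU.preimage (Continuous.prodMk_right x)).exists_lt_isCompact hx
  obtain ⟨V, W, hV, -, hxV, hKW, hVW⟩ := generalized_tube_lemma (isCompact_singleton (x := x)) hK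
    hU (by rintro ⟨_, y⟩ ⟨rfl, hy⟩; exact hKU hy)
  filter_upwards [hV.mem_nhds (hxV rfl)] with x' hx'
  exact hcK.trans_le (measure_mono fun y hy => hVW ⟨hx', hKW hy⟩)

theorem measure_le_half_of_disjoint {α : Type*} [MeasurableSpace α] {ν : Measure α} {A B : Set α}
    (hAB : Disjoint A B) (hB : MeasurableSet B) (hA : ν univ / 2 < ν A) : ν B ≤ ν univ / 2 := by
  by_contra! h
  refine (ENNReal.add_lt_add hA h).not_ge ?_
  rw [ENNReal.add_halves, ← measure_union hAB hB]
  exact measure_mono (subset_univ _)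

theorem measure_le_measure_compl_of_le_half {α : Type*} [MeasurableSpace α] {ν : Measure α}
    [IsFiniteMeasure ν] {A : Set α} (hA : MeasurableSet A) (h : ν A ≤ ν univ / 2) :
    ν A ≤ ν Aᶜ := by
  by_contra! hlt
  have hsum := ENNReal.add_lt_add_of_le_of_lt (measure_ne_top ν A) h (hlt.trans_le h)
  rw [measure_add_measure_compl hA, ENNReal.add_halves] at hsum
  exact hsum.false

theorem exists_median (ν : Measure ℝ) [IsFiniteMeasure ν] :
    ∃ m, ν (Ioi m) ≤ ν univ / 2 ∧ ν (Iio m) ≤ ν univ / 2 := by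
  rcases eq_or_ne (ν univ) 0 with hν | hν
  · simp [Measure.measure_univ_eq_zero.1 hν]
  have hhalf : ν univ / 2 < ν univ := ENNReal.half_lt_self hν (measure_ne_top ν univ)
  have hIoi : IsOpen {m | ν univ / 2 < ν (Ioi m)} :=
    isOpen_setOf_lt_measure_prodMk_left_preimage ν _ (isOpen_lt continuous_fst continuous_snd)
  have hIio : IsOpen {m | ν univ / 2 < ν (Iio m)} :=
    isOpen_setOf_lt_measure_prodMk_left_preimage ν _ (isOpen_lt continuous_snd continuous_fst)
  obtain ⟨b, hb⟩ := ((tendsto_measure_Iic_atTop ν).eventually_const_lt hhalf).exists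
  obtain ⟨a, ha⟩ := ((tendsto_measure_Ici_atBot ν).eventually_const_lt hhalf).exists
  obtain ⟨m, -, hm⟩ := isPreconnected_closed_iff.1 (isPreconnected_univ (α := ℝ)) _ _
    hIoi.isClosed_compl hIio.isClosed_compl
    (fun m _ => (em (ν univ / 2 < ν (Ioi m))).symm.imp_right fun h => not_lt.2
      (measure_le_half_of_disjoint ((Iio_disjoint_Ici le_rfl).symm.mono_left Ioi_subset_Ici_self)
        measurableSet_Iio h))
    ⟨b, mem_univ b, not_lt.2
      (measure_le_half_of_disjoint (Iic_disjoint_Ioi le_rfl) measurableSet_Ioi hb)⟩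
    ⟨a, mem_univ a, not_lt.2
      (measure_le_half_of_disjoint (Iio_disjoint_Ici le_rfl).symm measurableSet_Iio ha)⟩
  exact ⟨m, not_lt.1 hm.1, not_lt.1 hm.2⟩

theorem lintegral_enorm_eq_lintegral_tails (ν : Measure ℝ) [SFinite ν] :
    ∫⁻ s, ‖s‖ₑ ∂ν = ∫⁻ t, if 0 ≤ t then ν (Ioi t) else ν (Iic t) := by
  set T : Set (ℝ × ℝ) := {p | min p.1 0 ≤ p.2} ∩ {p | p.2 < max p.1 0}
  have hT : MeasurableSet T :=
    (measurableSet_le (measurable_fst.min measurable_const) measurable_snd).inter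
      (measurableSet_lt measurable_snd (measurable_fst.max measurable_const))
  have hfibre (s : ℝ) : volume (Prod.mk s ⁻¹' T) = ‖s‖ₑ := by
    change volume (Ico (min s 0) (max s 0)) = ‖s‖ₑ
    rw [Real.volume_Ico, max_sub_min_eq_abs, zero_sub, abs_neg, Real.enorm_eq_ofReal_abs]
  have htail (t : ℝ) : ν ((fun s => (s, t)) ⁻¹' T) = if 0 ≤ t then ν (Ioi t) else ν (Iic t) := by
    split_ifs with ht <;> congr 1 <;> ext s <;>
      simp only [T, mem_preimage, mem_inter_iff, mem_ofPred_eq, min_le_iff, lt_max_iff, mem_Ioi,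
        mem_Iic] <;> grind
  have htonelli := (Measure.prod_apply (μ := ν) (ν := volume) hT).symm.trans
    (Measure.prod_apply_symm hT)
  simpa only [hfibre, htail] using htonelli

theorem lintegral_enorm_le_lintegral_min_tails {ν : Measure ℝ} [IsFiniteMeasure ν]
    (hpos : ν (Ioi 0) ≤ ν univ / 2) (hneg : ν (Iio 0) ≤ ν univ / 2) :
    ∫⁻ s, ‖s‖ₑ ∂ν ≤ ∫⁻ t, min (ν (Ioi t)) (ν (Iic t)) := by
  rw [lintegral_enorm_eq_lintegral_tails]
  refine lintegral_mono fun t => ?_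
  dsimp only
  split_ifs with ht
  · refine le_min le_rfl ?_
    rw [← compl_Ioi]
    exact measure_le_measure_compl_of_le_half measurableSet_Ioi
      ((measure_mono (Ioi_subset_Ioi ht)).trans hpos)
  · refine le_min ?_ le_rfl
    rw [← compl_Iic]
    exact measure_le_measure_compl_of_le_half measurableSet_Iic
      ((measure_mono (Iic_subset_Iio.2 (not_le.1 ht))).trans hneg)

theorem lintegral_ofReal_le_of_hasDerivAt {φ φ' : ℝ → ℝ} {C : ℝ}
    (hφ : ∀ t, HasDerivAt φ (φ' t) t) (hφ' : Continuous φ') (hnonneg : ∀ t, 0 ≤ φ' t)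
    (hC : ∀ s t, φ t - φ s ≤ C) : ∫⁻ t, ENNReal.ofReal (φ' t) ≤ ENNReal.ofReal C := by
  have hlim := (aecover_Ioc (μ := volume) (tendsto_neg_atTop_atBot.comp tendsto_id)
    tendsto_id).lintegral_tendsto_of_countably_generated
      (ENNReal.continuous_ofReal.comp hφ').aemeasurable
  refine le_of_tendsto hlim ?_
  filter_upwards [eventually_ge_atTop (0 : ℝ)] with n hn
  have hint : IntegrableOn φ' (Ioc (-n) n) := hφ'.integrableOn_Ioc
  simp only [Function.comp_apply, id_eq]
  rw [← ofReal_integral_eq_lintegral_ofReal hint (ae_of_all _ hnonneg),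
    ← intervalIntegral.integral_of_le (by linarith),
    intervalIntegral.integral_eq_sub_of_hasDerivAt (fun t _ => hφ t) (hφ'.intervalIntegrable _ _)]
  exact ENNReal.ofReal_le_ofReal (hC _ _)

/-- Smooth functions of `s` which increase from `0` to `1` and, as `n → ∞`, approximate the
indicator function of `0 < s`. -/
noncomputable def smoothStep (n : ℕ) (s : ℝ) : ℝ := Real.smoothTransition ((n + 1) * s)

theorem contDiff_smoothStep (n : ℕ) : ContDiff ℝ 1 (smoothStep n) :=
  Real.smoothTransition.contDiff.comp (contDiff_const.mul contDiff_id)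

theorem monotone_smoothStep (n : ℕ) : Monotone (smoothStep n) := fun _ _ h =>
  Real.smoothTransition.monotone (mul_le_mul_of_nonneg_left h (by positivity))

theorem smoothStep_nonneg (n : ℕ) (s : ℝ) : 0 ≤ smoothStep n s := Real.smoothTransition.nonneg _

theorem smoothStep_le_one (n : ℕ) (s : ℝ) : smoothStep n s ≤ 1 := Real.smoothTransition.le_one _

theorem tendsto_smoothStep (s : ℝ) :
    Tendsto (fun n : ℕ => smoothStep n s) atTop (𝓝 (if 0 < s then 1 else 0)) := by
  split_ifs with hs
  · have hlarge : Tendsto (fun n : ℕ => ((n : ℝ) + 1) * s) atTop atTop :=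
      (tendsto_natCast_atTop_atTop.atTop_add tendsto_const_nhds).atTop_mul_const hs
    refine tendsto_const_nhds.congr' ?_
    filter_upwards [hlarge.eventually_ge_atTop 1] with n hn
    exact (Real.smoothTransition.one_of_one_le hn).symm
  · refine tendsto_const_nhds.congr fun n => (Real.smoothTransition.zero_of_nonpos ?_).symm
    exact mul_nonpos_of_nonneg_of_nonpos (by positivity) (not_lt.1 hs)

theorem lintegral_enorm_deriv_smoothStep_sub_le (n : ℕ) (y : ℝ) :
    ∫⁻ t, ‖deriv (smoothStep n) (y - t)‖ₑ ≤ 1 := by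
  have hderiv (t : ℝ) : HasDerivAt (fun t => -smoothStep n (y - t)) (deriv (smoothStep n) (y - t))
      t := by
    have h := ((contDiff_smoothStep n).differentiable one_ne_zero (y - t)).hasDerivAt
    simpa only [neg_neg] using (h.comp_const_sub y t).fun_neg
  have hnonneg (t : ℝ) : 0 ≤ deriv (smoothStep n) (y - t) := (monotone_smoothStep n).deriv_nonneg
  simp only [Real.enorm_of_nonneg (hnonneg _)]
  rw [← ENNReal.ofReal_one]
  refine lintegral_ofReal_le_of_hasDerivAt hderiv ?_ hnonneg fun s t => ?_
  · have := (contDiff_smoothStep n).continuous_deriv le_rfl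
    fun_prop
  · linarith [smoothStep_nonneg n (y - t), smoothStep_le_one n (y - s)]

theorem hasDerivAt_mul_abs (x : ℝ) : HasDerivAt (fun s : ℝ => s * |s|) (2 * |x|) x := by
  refine hasDerivAt_of_hasDerivAt_of_ne' (x := 0) (g := fun s => 2 * |s|) (fun y hy => ?_)
    (by fun_prop) (by fun_prop) x
  convert! (hasDerivAt_id y).mul (hasDerivAt_abs hy) using 1
  rw [id_eq, self_mul_sign, one_mul, two_mul]

theorem mul_abs_self_pos_iff {R : Type*} [Ring R] [LinearOrder R] [IsStrictOrderedRing R] {a : R} :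
    0 < a * |a| ↔ 0 < a := by
  rcases eq_or_ne a 0 with rfl | ha
  · simp
  · exact mul_pos_iff_of_pos_right (abs_pos.2 ha)

theorem mul_abs_self_neg_iff {R : Type*} [Ring R] [LinearOrder R] [IsStrictOrderedRing R] {a : R} :
    a * |a| < 0 ↔ a < 0 := by
  rw [← neg_pos, ← neg_mul, ← abs_neg, mul_abs_self_pos_iff, neg_pos]

/-! ### Cheeger's inequality -/

theorem sq_div_four_mul_le {h a b c : ℝ≥0∞} (ha : a ≠ ⊤) (hab : h * a ≤ 2 * b)
    (hbc : b ^ 2 ≤ a * c) : h ^ 2 / 4 * a ≤ c := by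
  rcases eq_or_ne a 0 with rfl | ha0
  · simp
  have hsq : a * (h ^ 2 * a) ≤ a * (4 * c) :=
    calc a * (h ^ 2 * a) = (h * a) ^ 2 := by ring
      _ ≤ (2 * b) ^ 2 := by gcongr
      _ = 4 * b ^ 2 := by ring
      _ ≤ 4 * (a * c) := by gcongr
      _ = a * (4 * c) := by ring
  rw [div_eq_mul_inv, mul_right_comm, ← div_eq_mul_inv]
  exact ENNReal.div_le_of_le_mul' ((ENNReal.mul_le_mul_iff_right ha0 ha).1 hsq)

namespace MetricGraph

variable {V E : Type*} {Γ : MetricGraph V E}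

/-- The function on the graph with values `c` at the vertices and `F e` inside the edge `e`. -/
def glue (Γ : MetricGraph V E) (c : V → ℝ) (F : E → ℝ → ℝ) : Γ.Point → ℝ
  | .vertex v => c v
  | .inner e x => F e x

/-- The functions `F e` are continuously differentiable with derivatives `F' e`, and their
restrictions to `[0, len e]` form a continuous function on the graph with vertex values `c`. All
`F e` are defined on the whole line so that no one-sided derivatives occur at the vertices. -/
structure IsC1 (Γ : MetricGraph V E) (c : V → ℝ) (F F' : E → ℝ → ℝ) : Prop where
  hasDerivAt : ∀ e x, HasDerivAt (F e) (F' e x) x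
  continuous_deriv : ∀ e, Continuous (F' e)
  source : ∀ e, F e 0 = c (Γ.source e)
  target : ∀ e, F e (Γ.len e) = c (Γ.target e)

namespace IsC1

variable {c : V → ℝ} {F F' : E → ℝ → ℝ}

theorem continuous (hF : Γ.IsC1 c F F') (e : E) : Continuous (F e) :=
  continuous_iff_continuousAt.2 fun x => (hF.hasDerivAt e x).continuousAt

theorem mem_formDomain (hF : Γ.IsC1 c F F') : (F, F') ∈ Γ.formDomain :=
  mem_formDomain_of_hasDerivAt hF.hasDerivAt hF.continuous_deriv
    ⟨c, fun e => ⟨hF.source e, hF.target e⟩⟩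

theorem comp {φ φ' : ℝ → ℝ} (hφ : ∀ s, HasDerivAt φ (φ' s) s) (hφ' : Continuous φ')
    (hF : Γ.IsC1 c F F') :
    Γ.IsC1 (fun v => φ (c v)) (fun e x => φ (F e x)) (fun e x => φ' (F e x) * F' e x) where
  hasDerivAt e x := (hφ (F e x)).comp x (hF.hasDerivAt e x)
  continuous_deriv e := (hφ'.comp (hF.continuous e)).mul (hF.continuous_deriv e)
  source e := congrArg φ (hF.source e)
  target e := congrArg φ (hF.target e)

theorem sub_const (hF : Γ.IsC1 c F F') (m : ℝ) :
    Γ.IsC1 (fun v => c v - m) (fun e x => F e x - m) F' := by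
  simpa only [one_mul] using
    hF.comp (fun s => (hasDerivAt_id' s).sub_const m) (continuous_const (y := (1 : ℝ)))

theorem glue_point (hF : Γ.IsC1 c F F') {e : E} {x : ℝ} (hx : x ∈ Icc 0 (Γ.len e)) :
    Γ.glue c F (Γ.point e x) = F e x := by
  rw [point]
  split_ifs with hinner h0
  · rfl
  · rw [le_antisymm h0 hx.1, hF.source, glue]
  · rw [le_antisymm hx.2 (not_lt.1 fun h => hinner ⟨not_le.1 h0, h⟩), hF.target, glue]

theorem coords_glue_preimage (hF : Γ.IsC1 c F F') (s : Set ℝ) (e : E) :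
    Γ.coords (Γ.glue c F ⁻¹' s) e = Icc 0 (Γ.len e) ∩ F e ⁻¹' s := by
  ext x
  refine and_congr_right fun hx => ?_
  rw [mem_preimage, mem_preimage, hF.glue_point hx]

theorem isMeasurable_glue_preimage (hF : Γ.IsC1 c F F') {s : Set ℝ} (hs : MeasurableSet s) :
    Γ.IsMeasurable (Γ.glue c F ⁻¹' s) := fun e => by
  rw [hF.coords_glue_preimage]
  exact (measurableSet_Icc.inter ((hF.continuous e).measurable hs)).nullMeasurableSet

theorem measurable_enorm_deriv_smoothStep_mul (hF : Γ.IsC1 c F F') (n : ℕ) (e : E) :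
    Measurable fun q : ℝ × ℝ => ‖deriv (smoothStep n) (F e q.2 - q.1)‖ₑ * ‖F' e q.2‖ₑ := by
  have := (contDiff_smoothStep n).continuous_deriv le_rfl
  have := hF.continuous e
  have := hF.continuous_deriv e
  exact (Continuous.enorm (by fun_prop)).measurable.mul (Continuous.enorm (by fun_prop)).measurable

end IsC1

theorem coords_univ (Γ : MetricGraph V E) (e : E) : Γ.coords univ e = Icc 0 (Γ.len e) := by
  ext x
  simp [coords]

theorem coords_compl (D : Set Γ.Point) (e : E) :
    Γ.coords Dᶜ e = Icc 0 (Γ.len e) \ Γ.coords D e := by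
  ext x
  simp only [coords, mem_ofPred_eq, mem_compl_iff, Set.mem_sdiff, not_and]
  tauto

section Finite

variable [Fintype E] {c : V → ℝ} {F F' f u w g : E → ℝ → ℝ}

/-- The Lebesgue integral over the graph of a nonnegative, possibly infinite, function. -/
noncomputable def lintegral (Γ : MetricGraph V E) (f : E → ℝ → ℝ≥0∞) : ℝ≥0∞ :=
  ∑ e, ∫⁻ x in Icc 0 (Γ.len e), f e x

theorem lintegral_mono {f f' : E → ℝ → ℝ≥0∞}
    (h : ∀ e, ∀ x ∈ Icc 0 (Γ.len e), f e x ≤ f' e x) : Γ.lintegral f ≤ Γ.lintegral f' :=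
  Finset.sum_le_sum fun e _ => setLIntegral_mono' measurableSet_Icc (h e)

theorem enorm_integral_le_lintegral_enorm (f : E → ℝ → ℝ) :
    ‖Γ.integral f‖ₑ ≤ Γ.lintegral fun e x => ‖f e x‖ₑ := by
  refine (enorm_sum_le _ _).trans (Finset.sum_le_sum fun e _ => ?_)
  rw [intervalIntegral.integral_of_le (Γ.len_pos e).le, ← integral_Icc_eq_integral_Ioc]
  exact MeasureTheory.enorm_integral_le_lintegral_enorm _

theorem lintegral_enorm_eq_ofReal_integral_abs (hf : ∀ e, Continuous (f e)) :
    Γ.lintegral (fun e x => ‖f e x‖ₑ) = ENNReal.ofReal (Γ.integral fun e x => |f e x|) := by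
  rw [integral, ENNReal.ofReal_sum_of_nonneg fun e _ =>
    intervalIntegral.integral_nonneg (Γ.len_pos e).le fun x _ => abs_nonneg (f e x)]
  refine Finset.sum_congr rfl fun e _ => ?_
  rw [intervalIntegral.integral_of_le (Γ.len_pos e).le, ← integral_Icc_eq_integral_Ioc]
  exact (ofReal_integral_norm_eq_lintegral_enorm (hf e).integrableOn_Icc).symm

theorem length_univ (Γ : MetricGraph V E) :
    Γ.length univ = ∑ e, ENNReal.ofReal (Γ.len e) := by
  simp [length, coords_univ]

theorem length_univ_ne_top (Γ : MetricGraph V E) : Γ.length univ ≠ ⊤ := by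
  rw [length_univ]
  exact ENNReal.sum_ne_top.2 fun _ _ => ENNReal.ofReal_ne_top

theorem length_add_length_compl {D : Set Γ.Point} (hD : Γ.IsMeasurable D) :
    Γ.length D + Γ.length Dᶜ = Γ.length univ := by
  simp only [length, ← Finset.sum_add_distrib, coords_compl, coords_univ]
  refine Finset.sum_congr rfl fun e _ => ?_
  rw [← measure_inter_add_sdiff₀ (Icc 0 (Γ.len e)) (hD e), inter_eq_right.2 fun x hx => hx.1]

theorem cheegerConstant_mul_min_length_le {D : Set Γ.Point} (hD : Γ.IsMeasurable D) :
    Γ.cheegerConstant * min (Γ.length D) (Γ.length Dᶜ) ≤ Γ.perimeter D := by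
  rcases eq_or_ne (min (Γ.length D) (Γ.length Dᶜ)) 0 with hmin | hmin
  · simp [hmin]
  obtain ⟨hpos, hpos'⟩ := lt_min_iff.1 (pos_iff_ne_zero.2 hmin)
  have hadd := length_add_length_compl hD
  have hlt : Γ.length D < Γ.length univ := hadd ▸ ENNReal.lt_add_right
    (ne_top_of_le_ne_top Γ.length_univ_ne_top (hadd ▸ le_self_add)) hpos'.ne'
  exact ENNReal.mul_le_of_le_div (iInf₂_le_of_le D hD (iInf₂_le hpos hlt))

/-- The distribution of `F` with respect to the length measure of the graph. -/
noncomputable def distribution (Γ : MetricGraph V E) (F : E → ℝ → ℝ) : Measure ℝ :=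
  ∑ e, (volume.restrict (Icc 0 (Γ.len e))).map (F e)

instance (Γ : MetricGraph V E) (F : E → ℝ → ℝ) : IsFiniteMeasure (Γ.distribution F) := by
  unfold distribution
  infer_instance

theorem lintegral_distribution (hF : ∀ e, Continuous (F e)) {φ : ℝ → ℝ≥0∞} (hφ : Measurable φ) :
    ∫⁻ s, φ s ∂Γ.distribution F = Γ.lintegral fun e x => φ (F e x) := by
  rw [distribution, lintegral_finsetSum_measure]
  exact Finset.sum_congr rfl fun e _ => lintegral_map hφ (hF e).measurable

theorem distribution_apply (hF : ∀ e, Continuous (F e)) {s : Set ℝ} (hs : MeasurableSet s) :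
    Γ.distribution F s = ∑ e, volume (Icc 0 (Γ.len e) ∩ F e ⁻¹' s) := by
  rw [distribution, Measure.finsetSum_apply]
  refine Finset.sum_congr rfl fun e _ => ?_
  rw [Measure.map_apply (hF e).measurable hs, Measure.restrict_apply ((hF e).measurable hs),
    inter_comm]

theorem distribution_comp_apply (hF : ∀ e, Continuous (F e)) {φ : ℝ → ℝ} (hφ : Continuous φ)
    {s : Set ℝ} (hs : MeasurableSet s) :
    Γ.distribution (fun e x => φ (F e x)) s = Γ.distribution F (φ ⁻¹' s) := by
  rw [distribution_apply (F := fun e x => φ (F e x)) (fun e => hφ.comp (hF e)) hs,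
    distribution_apply hF (hφ.measurable hs)]
  rfl

theorem IsC1.length_glue_preimage (hF : Γ.IsC1 c F F') {s : Set ℝ} (hs : MeasurableSet s) :
    Γ.length (Γ.glue c F ⁻¹' s) = Γ.distribution F s := by
  rw [distribution_apply hF.continuous hs]
  exact Finset.sum_congr rfl fun e _ => congrArg volume (hF.coords_glue_preimage s e)

theorem totalVariation_le_lintegral_enorm {p : (E → ℝ → ℝ) × (E → ℝ → ℝ)}
    (hp : p ∈ Γ.formDomain) :
    Γ.totalVariation p.1 ≤ Γ.lintegral fun e x => ‖p.2 e x‖ₑ := by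
  refine iSup₂_le fun z g => iSup₂_le fun hz hk => iSup_le fun hz1 => ?_
  have hgreen : Γ.l2Inner g p.1 = -Γ.l2Inner z p.2 :=
    eq_neg_of_add_eq_zero_left (hz.kirchhoff_iff.1 hk p hp)
  rw [← Real.enorm_eq_ofReal_abs]
  change ‖Γ.l2Inner p.1 g‖ₑ ≤ _
  rw [l2Inner_comm, hgreen, enorm_neg]
  refine (enorm_integral_le_lintegral_enorm _).trans (lintegral_mono fun e x hx => ?_)
  rw [enorm_mul]
  refine mul_le_of_le_one_left zero_le ?_
  rw [Real.enorm_eq_ofReal_abs, ENNReal.ofReal_le_one]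
  exact hz1 e x hx

theorem totalVariation_le_liminf {w : ℕ → E → ℝ → ℝ} {C : ℝ}
    (hw : ∀ n e, ContinuousOn (w n e) (Icc 0 (Γ.len e)))
    (hC : ∀ n e, ∀ x ∈ Icc 0 (Γ.len e), |w n e x| ≤ C)
    (hlim : ∀ e, ∀ x ∈ Icc 0 (Γ.len e), Tendsto (fun n => w n e x) atTop (𝓝 (u e x))) :
    Γ.totalVariation u ≤ liminf (fun n => Γ.totalVariation (w n)) atTop := by
  refine iSup₂_le fun z g => iSup₂_le fun hz hk => iSup_le fun hz1 => ?_
  have hsub : ∀ e, uIoc 0 (Γ.len e) ⊆ Icc 0 (Γ.len e) := fun e => by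
    rw [uIoc_of_le (Γ.len_pos e).le]
    exact Ioc_subset_Icc_self
  have hint : Tendsto (fun n => Γ.integral fun e x => w n e x * g e x) atTop
      (𝓝 (Γ.integral fun e x => u e x * g e x)) := by
    refine tendsto_finsetSum _ fun e _ => ?_
    have hg := hz.isL2_deriv.isL1 e
    refine intervalIntegral.tendsto_integral_filter_of_dominated_convergence (fun x => C * ‖g e x‖)
      (.of_forall fun n => ?_) (.of_forall fun n => ae_of_all _ fun x hx => ?_)
      (hg.norm.const_mul C) (ae_of_all _ fun x hx => (hlim e x (hsub e hx)).mul_const _)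
    · exact (((hw n e).mono (hsub e)).aestronglyMeasurable measurableSet_uIoc).mul
        hg.aestronglyMeasurable_restrict_uIoc
    · rw [norm_mul]
      exact mul_le_mul_of_nonneg_right (hC n e x (hsub e hx)) (norm_nonneg _)
  rw [← (ENNReal.tendsto_ofReal hint.abs).liminf_eq]
  exact liminf_le_liminf (.of_forall fun n =>
    le_iSup₂_of_le z g (le_iSup₂_of_le hz hk (le_iSup_of_le hz1 le_rfl)))

theorem IsC1.perimeter_superlevel_le_liminf (hF : Γ.IsC1 c F F') (t : ℝ) :
    Γ.perimeter (Γ.glue c F ⁻¹' Ioi t) ≤ liminf (fun n : ℕ => Γ.lintegral fun e x =>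
      ‖deriv (smoothStep n) (F e x - t)‖ₑ * ‖F' e x‖ₑ) atTop := by
  have hstep (n : ℕ) := (hF.sub_const t).comp
    (fun s => ((contDiff_smoothStep n).differentiable one_ne_zero s).hasDerivAt)
    ((contDiff_smoothStep n).continuous_deriv le_rfl)
  have hbound (n : ℕ) (s : ℝ) : |smoothStep n s| ≤ 1 := by
    rw [abs_of_nonneg (smoothStep_nonneg n s)]
    exact smoothStep_le_one n s
  refine (totalVariation_le_liminf (fun n e => ((hstep n).continuous e).continuousOn)
    (fun n e x _ => hbound n _) fun e x hx => ?_).trans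
    (liminf_le_liminf (.of_forall fun n => ?_))
  · classical
    convert! tendsto_smoothStep (F e x - t) using 2
    rw [indicator, hF.coords_glue_preimage, indicator_apply]
    simp only [mem_inter_iff, hx, true_and, mem_preimage, mem_Ioi, sub_pos, Pi.one_apply]
  · simpa only [enorm_mul] using totalVariation_le_lintegral_enorm (hstep n).mem_formDomain

/-- The inequality `≤` of the coarea formula. The indicator of `(t, ∞)` is a limit of smooth steps;
their total variations are integrated over `t` before the limit is taken by Fatou's lemma. -/
theorem IsC1.lintegral_perimeter_superlevel_le (hF : Γ.IsC1 c F F') :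
    ∫⁻ t, Γ.perimeter (Γ.glue c F ⁻¹' Ioi t) ≤ Γ.lintegral fun e x => ‖F' e x‖ₑ := by
  have hmeas := hF.measurable_enorm_deriv_smoothStep_mul
  have hedge (n : ℕ) (e : E) : Measurable fun t => ∫⁻ x in Icc 0 (Γ.len e),
      ‖deriv (smoothStep n) (F e x - t)‖ₑ * ‖F' e x‖ₑ := (hmeas n e).lintegral_prod_right'
  have hlayer (n : ℕ) : ∫⁻ t, Γ.lintegral (fun e x =>
      ‖deriv (smoothStep n) (F e x - t)‖ₑ * ‖F' e x‖ₑ) ≤ Γ.lintegral fun e x => ‖F' e x‖ₑ := by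
    simp only [lintegral]
    rw [lintegral_finsetSum _ fun e _ => hedge n e]
    refine Finset.sum_le_sum fun e _ => ?_
    rw [lintegral_lintegral_swap (hmeas n e).aemeasurable]
    refine MeasureTheory.lintegral_mono fun x => ?_
    dsimp only
    rw [lintegral_mul_const' _ _ enorm_ne_top]
    exact mul_le_of_le_one_left zero_le (lintegral_enorm_deriv_smoothStep_sub_le n (F e x))
  calc ∫⁻ t, Γ.perimeter (Γ.glue c F ⁻¹' Ioi t)
      ≤ ∫⁻ t, liminf (fun n : ℕ => Γ.lintegral fun e x =>
          ‖deriv (smoothStep n) (F e x - t)‖ₑ * ‖F' e x‖ₑ) atTop :=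
        MeasureTheory.lintegral_mono hF.perimeter_superlevel_le_liminf
    _ ≤ liminf (fun n : ℕ => ∫⁻ t, Γ.lintegral fun e x =>
          ‖deriv (smoothStep n) (F e x - t)‖ₑ * ‖F' e x‖ₑ) atTop :=
        lintegral_liminf_le fun n => Finset.measurable_fun_sum _ fun e _ => hedge n e
    _ ≤ Γ.lintegral fun e x => ‖F' e x‖ₑ :=
        liminf_le_of_le (by isBoundedDefault) fun b hb =>
          hb.exists.elim fun n hn => hn.trans (hlayer n)

theorem IsC1.cheegerConstant_mul_lintegral_enorm_le (hF : Γ.IsC1 c F F')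
    (hpos : Γ.distribution F (Ioi 0) ≤ Γ.distribution F univ / 2)
    (hneg : Γ.distribution F (Iio 0) ≤ Γ.distribution F univ / 2) :
    Γ.cheegerConstant * Γ.lintegral (fun e x => ‖F e x‖ₑ)
      ≤ Γ.lintegral fun e x => ‖F' e x‖ₑ := by
  have hlevel (t : ℝ) : Γ.cheegerConstant *
      min (Γ.distribution F (Ioi t)) (Γ.distribution F (Iic t))
        ≤ Γ.perimeter (Γ.glue c F ⁻¹' Ioi t) := by
    rw [← hF.length_glue_preimage measurableSet_Ioi, ← hF.length_glue_preimage measurableSet_Iic,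
      ← compl_Ioi, preimage_compl]
    exact cheegerConstant_mul_min_length_le (hF.isMeasurable_glue_preimage measurableSet_Ioi)
  rw [← lintegral_distribution hF.continuous measurable_enorm]
  calc Γ.cheegerConstant * ∫⁻ s, ‖s‖ₑ ∂Γ.distribution F
      ≤ Γ.cheegerConstant *
          ∫⁻ t, min (Γ.distribution F (Ioi t)) (Γ.distribution F (Iic t)) :=
        mul_le_mul_right (lintegral_enorm_le_lintegral_min_tails hpos hneg) _
    _ ≤ ∫⁻ t, Γ.cheegerConstant *
          min (Γ.distribution F (Ioi t)) (Γ.distribution F (Iic t)) := lintegral_const_mul_le _ _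
    _ ≤ ∫⁻ t, Γ.perimeter (Γ.glue c F ⁻¹' Ioi t) := MeasureTheory.lintegral_mono hlevel
    _ ≤ Γ.lintegral fun e x => ‖F' e x‖ₑ := hF.lintegral_perimeter_superlevel_le

end Finite

end MetricGraph

namespace MetricGraph

variable {V E : Type*} {Γ : MetricGraph V E} {c : V → ℝ} {F F' u g : E → ℝ → ℝ}

theorem exists_isC1_eqOn (hug : (u, g) ∈ Γ.formDomain)
    (hg : ∀ e, ContinuousOn (g e) (Icc 0 (Γ.len e))) :
    ∃ c F F', Γ.IsC1 c F F' ∧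
      ∀ e, EqOn (F e) (u e) (Icc 0 (Γ.len e)) ∧ EqOn (F' e) (g e) (Icc 0 (Γ.len e)) := by
  obtain ⟨hu, c, hc⟩ := hug
  set F' : E → ℝ → ℝ := fun e => IccExtend (Γ.len_pos e).le ((Icc 0 (Γ.len e)).domRestrict (g e))
  have hF' : ∀ e, Continuous (F' e) := fun e => (hg e).domRestrict.Icc_extend'
  have hF'g : ∀ e, EqOn (F' e) (g e) (Icc 0 (Γ.len e)) := fun e x hx => IccExtend_of_mem _ _ hx
  set F : E → ℝ → ℝ := fun e x => u e 0 + ∫ t in 0..x, F' e t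
  have hFu : ∀ e, EqOn (F e) (u e) (Icc 0 (Γ.len e)) := fun e x hx => by
    refine Eq.trans ?_ ((hu.isPrimitiveOn e).eq_add_integral x hx).symm
    refine congrArg (u e 0 + ·) (intervalIntegral.integral_congr fun t ht => hF'g e ?_)
    rw [uIcc_of_le hx.1] at ht
    exact ⟨ht.1, ht.2.trans hx.2⟩
  exact ⟨c, F, F',
    { hasDerivAt := fun e x => ((hF' e).integral_hasStrictDerivAt 0 x).hasDerivAt.const_add _
      continuous_deriv := hF'
      source := fun e => (hFu e (Γ.zero_mem_Icc e)).trans (hc e).1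
      target := fun e => (hFu e (Γ.len_mem_Icc e)).trans (hc e).2 },
    fun e => ⟨hFu e, hF'g e⟩⟩

variable [Fintype E]

theorem l2NormSq_congr (huw : ∀ e, EqOn (u e) (g e) (Icc 0 (Γ.len e))) :
    Γ.l2NormSq u = Γ.l2NormSq g :=
  integral_congr_ae fun e => by
    filter_upwards [ae_restrict_mem measurableSet_Ioo] with x hx
    rw [huw e (Ioo_subset_Icc_self hx)]

theorem l2NormSq_le_l2NormSq_sub_const (hu : Γ.IsL2 u) (hmean : Γ.integral u = 0) (m : ℝ) :
    Γ.l2NormSq u ≤ Γ.l2NormSq fun e x => u e x - m := by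
  have hone : Γ.IsL2 1 := isL2_of_continuousOn fun _ => continuousOn_const
  have hinner : Γ.l2Inner u 1 = 0 := by simpa only [l2Inner, Pi.one_apply, mul_one] using hmean
  have hexpand := l2NormSq_add_smul hu hone (-m)
  rw [hinner, mul_zero, add_zero] at hexpand
  have hsub : (fun e x => u e x - m) = u + -m • 1 := by
    ext e x
    simp [sub_eq_add_neg]
  rw [hsub, hexpand]
  exact le_add_of_nonneg_right (mul_nonneg (sq_nonneg _) (Γ.l2NormSq_nonneg _))

theorem IsC1.cheegerConstant_mul_l2NormSq_le (hF : Γ.IsC1 c F F')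
    (hpos : Γ.distribution F (Ioi 0) ≤ Γ.distribution F univ / 2)
    (hneg : Γ.distribution F (Iio 0) ≤ Γ.distribution F univ / 2) :
    Γ.cheegerConstant * ENNReal.ofReal (Γ.l2NormSq F)
      ≤ 2 * ENNReal.ofReal (Γ.l2Inner (fun e x => |F e x|) fun e x => |F' e x|) := by
  have hW := hF.comp hasDerivAt_mul_abs (by fun_prop)
  have hdist {s : Set ℝ} (hs : MeasurableSet s) :
      Γ.distribution (fun e x => F e x * |F e x|) s
        = Γ.distribution F ((fun y => y * |y|) ⁻¹' s) :=
    distribution_comp_apply (φ := fun y => y * |y|) hF.continuous (by fun_prop) hs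
  have hIoi : (fun y : ℝ => y * |y|) ⁻¹' Ioi 0 = Ioi 0 := ext fun y => mul_abs_self_pos_iff (a := y)
  have hIio : (fun y : ℝ => y * |y|) ⁻¹' Iio 0 = Iio 0 := ext fun y => mul_abs_self_neg_iff (a := y)
  have hcheeger := hW.cheegerConstant_mul_lintegral_enorm_le
    (by rwa [hdist measurableSet_Ioi, hIoi, hdist .univ, preimage_univ])
    (by rwa [hdist measurableSet_Iio, hIio, hdist .univ, preimage_univ])
  rw [lintegral_enorm_eq_ofReal_integral_abs hW.continuous,
    lintegral_enorm_eq_ofReal_integral_abs hW.continuous_deriv] at hcheeger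
  convert! hcheeger using 1
  · simp only [abs_mul, abs_abs, abs_mul_abs_self, l2NormSq, sq]
  · rw [← ENNReal.ofReal_ofNat 2, ← ENNReal.ofReal_mul zero_le_two, l2Inner, ← integral_smul]
    simp only [abs_mul, abs_abs, abs_two, mul_assoc, Pi.smul_def, smul_eq_mul]

theorem sq_ofReal_l2Inner_abs_le (hu : Γ.IsL2 u) (hg : Γ.IsL2 g) :
    ENNReal.ofReal (Γ.l2Inner (fun e x => |u e x|) fun e x => |g e x|) ^ 2
      ≤ ENNReal.ofReal (Γ.l2NormSq u) * ENNReal.ofReal (Γ.l2NormSq g) := by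
  have hinner : 0 ≤ Γ.l2Inner (fun e x => |u e x|) fun e x => |g e x| :=
    Finset.sum_nonneg fun e _ =>
      intervalIntegral.integral_nonneg (Γ.len_pos e).le fun x _ => by positivity
  rw [← ENNReal.ofReal_pow hinner, ← ENNReal.ofReal_mul (Γ.l2NormSq_nonneg u)]
  refine ENNReal.ofReal_le_ofReal ((sq_l2Inner_le (fun e => (hu e).abs) fun e =>
    (hg e).abs).trans_eq ?_)
  simp only [l2NormSq, Pi.abs_apply, sq_abs]

theorem IsC1.exists_sq_cheegerConstant_div_four_mul_le (hF : Γ.IsC1 c F F') :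
    ∃ m, Γ.cheegerConstant ^ 2 / 4 * ENNReal.ofReal (Γ.l2NormSq fun e x => F e x - m)
      ≤ ENNReal.ofReal (Γ.l2NormSq F') := by
  obtain ⟨m, hpos, hneg⟩ := exists_median (Γ.distribution F)
  have hv := hF.sub_const m
  have hdist {s : Set ℝ} (hs : MeasurableSet s) :
      Γ.distribution (fun e x => F e x - m) s = Γ.distribution F ((fun y => y - m) ⁻¹' s) :=
    distribution_comp_apply (φ := fun y => y - m) hF.continuous (by fun_prop) hs
  have hcheeger := hv.cheegerConstant_mul_l2NormSq_le
    (by simpa only [hdist measurableSet_Ioi, hdist .univ, preimage_sub_const_Ioi, zero_add,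
      preimage_univ] using hpos)
    (by simpa only [hdist measurableSet_Iio, hdist .univ, preimage_sub_const_Iio, zero_add,
      preimage_univ] using hneg)
  exact ⟨m, sq_div_four_mul_le ENNReal.ofReal_ne_top hcheeger
    (sq_ofReal_l2Inner_abs_le hv.mem_formDomain.1.isL2 hv.mem_formDomain.1.isL2_deriv)⟩

theorem sq_cheegerConstant_div_four_mul_l2NormSq_le (hug : (u, g) ∈ Γ.formDomain)
    (hg : ∀ e, ContinuousOn (g e) (Icc 0 (Γ.len e))) (hmean : Γ.integral u = 0) :
    Γ.cheegerConstant ^ 2 / 4 * ENNReal.ofReal (Γ.l2NormSq u)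
      ≤ ENNReal.ofReal (Γ.l2NormSq g) := by
  obtain ⟨c, F, F', hF, heq⟩ := exists_isC1_eqOn hug hg
  obtain ⟨m, hm⟩ := hF.exists_sq_cheegerConstant_div_four_mul_le
  rw [l2NormSq_congr fun e => (heq e).2] at hm
  have hshift : Γ.l2NormSq (fun e x => F e x - m) = Γ.l2NormSq fun e x => u e x - m :=
    l2NormSq_congr fun e => (heq e).1.comp_left (g := fun y => y - m)
  rw [hshift] at hm
  refine (mul_le_mul_right (ENNReal.ofReal_le_ofReal ?_) _).trans hm
  exact l2NormSq_le_l2NormSq_sub_const hug.1.isL2 hmean m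

theorem sq_cheegerConstant_div_four_le_of_mem_nonzeroEigenvalues {μ : ℝ}
    (hμ : μ ∈ Γ.nonzeroEigenvalues) : Γ.cheegerConstant ^ 2 / 4 ≤ ENNReal.ofReal μ := by
  obtain ⟨hμ0, u, f, ⟨g, hu, hg, hv, hk⟩, hne, hf⟩ := hμ
  have hweak : ∀ q ∈ Γ.formDomain, Γ.l2Inner g q.2 = μ * Γ.l2Inner u q.1 :=
    fun q hq => l2Inner_deriv_eq_mul_l2Inner hg hk hf hq
  have hcheeger := sq_cheegerConstant_div_four_mul_l2NormSq_le ⟨hu, hv⟩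
    (fun e => (hg e).continuousOn) (integral_eq_zero_of_forall_l2Inner_eq hμ0 hweak)
  have hpos : 0 < Γ.l2NormSq u := (Γ.l2NormSq_nonneg u).lt_of_ne' hne
  have henergy : Γ.l2NormSq g = μ * Γ.l2NormSq u := by
    simpa only [l2NormSq_eq_l2Inner] using hweak (u, g) ⟨hu, hv⟩
  rw [henergy, ENNReal.ofReal_mul' hpos.le] at hcheeger
  exact (ENNReal.mul_le_mul_iff_left (ENNReal.ofReal_pos.2 hpos).ne' ENNReal.ofReal_ne_top).1
    hcheeger

end MetricGraph

theorem mainTheorem7 {V E : Type*} [Finite V] [Fintype E] [Nonempty E] (Γ : MetricGraph V E)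
    (hΓ : Γ.toSimpleGraph.Connected) :
    IsLeast Γ.nonzeroEigenvalues Γ.spectralGap ∧
      IsLeast Γ.rayleighQuotients Γ.spectralGap ∧
      Γ.cheegerConstant ^ 2 / 4 ≤ ENNReal.ofReal Γ.spectralGap := by
  obtain ⟨lam, hlam⟩ := MetricGraph.exists_isLeast_rayleighQuotients hΓ
  have heig : IsLeast Γ.nonzeroEigenvalues lam :=
    MetricGraph.isLeast_nonzeroEigenvalues_of_isLeast_rayleighQuotients hΓ hlam
  have hgap : Γ.spectralGap = lam := heig.csInf_eq
  rw [hgap]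
  exact ⟨heig, hlam, MetricGraph.sq_cheegerConstant_div_four_le_of_mem_nonzeroEigenvalues heig.1⟩
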